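/- **Notation.** A packed matrix is a matrix with entries in $\mathbb{N}$ having no zero row and no zero column; the empty matrix $1$ is packed. $\mathrm{Pack}$ is the set of packed matrices and $\mathbf{H}_{\mathrm{Pack}}$ is the $\mathbb{Q}$-vector space with basis $\mathrm{Pack}$. For $M\in\mathrm{Pack}$, $\mathrm{row}(M)$, $\mathrm{col}(M)$ and $\omega(M)$ denote its number of rows, its number of columns and the sum of its entries, and $M\searrow N=\begin{pmatrix}M&0\\0&N\end{pmatrix}$. For a map $\alpha:[k]\to[l]$, $\mu(\alpha)\in\mathcal{M}_{l,k}(\mathbb{N})$ is the matrix with entries $\mu(\alpha)_{i,j}=\delta_{i,\alpha(j)}$. $\mathrm{qsh}(k,l)$ is the set of surjections $\sigma:[k+l]\to[n]$ ($n\in\mathbb{N}$) with $\sigma(1)<\dots<\sigma(k)$ and $\sigma(k+1)<\dots<\sigma(k+l)$. $\mathrm{Adm}(k)$ is the set of pairs of surjections $\sigma':[k]\to[k']$, $\sigma'':[k]\to[k'']$ such that $\sigma'$ is weakly increasing and $\sigma''(i)<\sigma''(j)$ whenever $i<j$ and $\sigma'(i)=\sigma'(j)$. Finally $H_n(X)=X(X-1)\cdots(X-n+1)/n!$.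 The double bialgebra $(\mathbf{H}_{\mathrm{Pack}},\squplus,\Delta,\delta)$ has unit $1$ and is given, for $M,N\in\mathrm{Pack}$, by $$M\squplus N=\sum_{\substack{\sigma\in\mathrm{qsh}(\mathrm{row}(M),\mathrm{row}(N))\\ \tau\in\mathrm{qsh}(\mathrm{col}(M),\mathrm{col}(N))}}\mu(\sigma)(M\searrow N)\mu(\tau)^\top,\qquad \Delta(M)=\sum_{M=M'\searrow M''}M'\otimes M'',$$ $$\delta(M)=\sum_{\substack{(\sigma',\sigma'')\in\mathrm{Adm}(\mathrm{row}(M))\\ (\tau',\tau'')\in\mathrm{Adm}(\mathrm{col}(M))}}\mu(\sigma')M\mu(\tau')^\top\otimes\mu(\sigma'')M\mu(\tau'')^\top,$$ where $M',M''$ are packed. The counit of $\Delta$ is $\varepsilon_\Delta(M)=\delta_{M,1}$. The counit $\epsilon_\delta$ of $\delta$ is $1$ on the empty matrix and on $1\times1$ matrices, and $0$ on the other packed matrices. The double bialgebra $(\mathbf{QSym},\squplus,\Delta,\delta)$ has as basis the compositions (finite, possibly empty, sequences of positive integers); its unit is the empty composition, its product is the quasi-shuffle product $$(\nu_1,\dots,\nu_k)\squplus(\nu_{k+1},\dots,\nu_{k+l})=\sum_{\sigma\in\mathrm{qsh}(k,l)}\Big(\sum_{\sigma(i)=1}\nu_i,\dots,\sum_{\sigma(i)=\max\sigma}\nu_i\Big),$$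 $\Delta$ is deconcatenation, and $\delta(a)=\sum r(\nu)\otimes c(\nu)$, the sum being over the packed matrices $\nu$ whose nonzero entries, read row by row from left to right, form the composition $a$; here $r(\nu)$ and $c(\nu)$ are the sequences of row sums and of column sums of $\nu$. The counit of $\Delta$ is $1$ on the empty composition and $0$ on the others; the counit of $\delta$ is $1$ on compositions with at most one part and $0$ on the others. A bialgebra morphism is a linear map preserving product, unit, $\Delta$ and $\varepsilon_\Delta$; a double bialgebra morphism is a bialgebra morphism preserving also $\delta$ and its counit $\epsilon_\delta$. For $x,y\in\mathbb{Q}$, let $K_{x,y}$ be the linear map from $\mathbf{NSym}$ (the space with basis the compositions) to $\mathbf{H}_{\mathrm{Pack}}$ with $$K_{x,y}(a_1,\dots,a_n)=\sum_{\substack{M_1,\dots,M_n\in\mathrm{Pack}\\ \omega(M_i)=a_i}}\Big(\prod_{i=1}^n H_{\mathrm{row}(M_i)}(x)H_{\mathrm{col}(M_i)}(y)\Big)M_1\searrow\dots\searrow M_n,$$ and let $\kappa_{x,y}:\mathbf{H}_{\mathrm{Pack}}\to\mathbf{QSym}$ be the linear map with $$\kappa_{x,y}(M)=\sum_{k\ge0}\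 \sum_{\substack{M=M_1\searrow\dots\searrow M_k\\ M_i\in\mathrm{Pack},\ M_i\ne1}}\Big(\prod_{i=1}^kH_{\mathrm{row}(M_i)}(x)H_{\mathrm{col}(M_i)}(y)\Big)(\omega(M_1),\dots,\omega(M_k)).$$ **Theorem.** 1. For all $x,y\in\mathbb{Q}$, $\kappa_{x,y}$ is dual to $K_{x,y}$: for every packed matrix $M$ and every composition $a$, the coefficient of $a$ in $\kappa_{x,y}(M)$ equals the coefficient of $M$ in $K_{x,y}(a)$. Moreover, $\kappa_{x,y}$ is a bialgebra morphism from $(\mathbf{H}_{\mathrm{Pack}},\squplus,\Delta)$ to $(\mathbf{QSym},\squplus,\Delta)$. 2. For all $x,y\in\mathbb{Q}$, $\kappa_{x,y}$ is a double bialgebra morphism from $(\mathbf{H}_{\mathrm{Pack}},\squplus,\Delta,\delta)$ to $(\mathbf{QSym},\squplus,\Delta,\delta)$ if and only if $x=y=1$. 3. For every packed matrix $M$, $\kappa_{1,1}(M)=\mathrm{diag}(M)$, the composition of the diagonal entries of $M$, if $M$ is a (square) diagonal matrix, and $\kappa_{1,1}(M)=0$ otherwise. The empty matrix is diagonal, with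 $\mathrm{diag}(1)$ the empty composition. -/

import Mathlib

open scoped TensorProduct Matrix

noncomputable section

/-! ### Packed matrices -/

/-- A packed matrix: a matrix of natural numbers without zero row and without zero column. The
conditions force `row = 0 ↔ col = 0`, so the only degenerate case is the empty matrix. -/
@[ext]
structure PackedMatrix where
  row : ℕ
  col : ℕ
  entry : Matrix (Fin row) (Fin col) ℕ
  row_ne_zero : ∀ i, ∃ j, entry i j ≠ 0
  col_ne_zero : ∀ j, ∃ i, entry i j ≠ 0

namespace PackedMatrix

/-- The empty matrix, denoted `1`. -/
def empty : PackedMatrix where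
  row := 0
  col := 0
  entry := 0
  row_ne_zero i := i.elim0
  col_ne_zero j := j.elim0

/-- The weight `ω(M)`: the sum of all entries. -/
def weight (M : PackedMatrix) : ℕ := ∑ i, ∑ j, M.entry i j

theorem sum_row_pos (M : PackedMatrix) (i : Fin M.row) : 0 < ∑ j, M.entry i j := by
  obtain ⟨j, hj⟩ := M.row_ne_zero i
  exact lt_of_lt_of_le (Nat.pos_of_ne_zero hj)
    (Finset.single_le_sum (f := fun j => M.entry i j) (fun _ _ => Nat.zero_le _)
      (Finset.mem_univ j))

theorem sum_col_pos (M : PackedMatrix) (j : Fin M.col) : 0 < ∑ i, M.entry i j := by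
  obtain ⟨i, hi⟩ := M.col_ne_zero j
  exact lt_of_lt_of_le (Nat.pos_of_ne_zero hi)
    (Finset.single_le_sum (f := fun i => M.entry i j) (fun _ _ => Nat.zero_le _)
      (Finset.mem_univ i))

theorem row_le_weight (M : PackedMatrix) : M.row ≤ M.weight := by
  have h : ∑ _i : Fin M.row, 1 ≤ M.weight := Finset.sum_le_sum fun i _ => M.sum_row_pos i
  simpa using h

theorem col_le_weight (M : PackedMatrix) : M.col ≤ M.weight := by
  have h : ∑ _j : Fin M.col, 1 ≤ ∑ j, ∑ i, M.entry i j :=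
    Finset.sum_le_sum fun j _ => M.sum_col_pos j
  rw [Finset.sum_comm] at h
  simpa [weight] using h

theorem entry_le_weight (M : PackedMatrix) (i : Fin M.row) (j : Fin M.col) :
    M.entry i j ≤ M.weight :=
  (Finset.single_le_sum (f := fun j => M.entry i j) (fun _ _ => Nat.zero_le _)
    (Finset.mem_univ j)).trans
    (Finset.single_le_sum (f := fun i => ∑ j, M.entry i j) (fun _ _ => Nat.zero_le _)
      (Finset.mem_univ i))

theorem finite_weight_le (n : ℕ) : {M : PackedMatrix | M.weight ≤ n}.Finite := by
  classical
  let S := Σ p : Fin (n + 1) × Fin (n + 1),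
    {A : Fin p.1 → Fin p.2 → Fin (n + 1) //
      (∀ i, ∃ j, (A i j : ℕ) ≠ 0) ∧ (∀ j, ∃ i, (A i j : ℕ) ≠ 0)}
  let g : S → PackedMatrix := fun s =>
    ⟨s.1.1, s.1.2, Matrix.of fun i j => (s.2.1 i j : ℕ), s.2.2.1, s.2.2.2⟩
  refine (Set.finite_range g).subset ?_
  intro M hM
  have hM : M.weight ≤ n := hM
  have h1 := M.row_le_weight
  have h2 := M.col_le_weight
  have h3 := M.entry_le_weight
  exact ⟨⟨(⟨M.row, by omega⟩, ⟨M.col, by omega⟩),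
    ⟨fun i j => ⟨M.entry i j, by have := h3 i j; omega⟩, M.row_ne_zero, M.col_ne_zero⟩⟩, rfl⟩

theorem finite_weight_eq (n : ℕ) : {M : PackedMatrix | M.weight = n}.Finite :=
  (finite_weight_le n).subset fun _ h => le_of_eq h

/-- The finite set of packed matrices of weight `n`. -/
def ofWeight (n : ℕ) : Finset PackedMatrix := (finite_weight_eq n).toFinset

@[simp] theorem mem_ofWeight {n : ℕ} {M : PackedMatrix} : M ∈ ofWeight n ↔ M.weight = n := by
  simp [ofWeight]

/-- The block diagonal matrix `M ↘ N`. -/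
def diagSum (M N : PackedMatrix) : PackedMatrix where
  row := M.row + N.row
  col := M.col + N.col
  entry := Matrix.reindex finSumFinEquiv finSumFinEquiv
    (Matrix.fromBlocks M.entry 0 0 N.entry)
  row_ne_zero i := by
    obtain ⟨i, rfl⟩ := finSumFinEquiv.surjective i
    rcases i with i | i
    · obtain ⟨j, hj⟩ := M.row_ne_zero i
      exact ⟨finSumFinEquiv (Sum.inl j), by simpa using hj⟩
    · obtain ⟨j, hj⟩ := N.row_ne_zero i
      exact ⟨finSumFinEquiv (Sum.inr j), by simpa using hj⟩
  col_ne_zero j := by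
    obtain ⟨j, rfl⟩ := finSumFinEquiv.surjective j
    rcases j with j | j
    · obtain ⟨i, hi⟩ := M.col_ne_zero j
      exact ⟨finSumFinEquiv (Sum.inl i), by simpa using hi⟩
    · obtain ⟨i, hi⟩ := N.col_ne_zero j
      exact ⟨finSumFinEquiv (Sum.inr i), by simpa using hi⟩

theorem weight_diagSum (M N : PackedMatrix) :
    (M.diagSum N).weight = M.weight + N.weight := by
  change ∑ i : Fin (M.row + N.row), ∑ j : Fin (M.col + N.col),
    (Matrix.reindex finSumFinEquiv finSumFinEquiv
      (Matrix.fromBlocks M.entry 0 0 N.entry)) i j = _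
  rw [← finSumFinEquiv.sum_comp, Fintype.sum_sum_type]
  simp only [← (finSumFinEquiv (m := M.col) (n := N.col)).sum_comp, Fintype.sum_sum_type]
  simp [weight]

/-- `M₁ ↘ ⋯ ↘ M_k`, the empty product being the empty matrix. -/
def diagProd (L : List PackedMatrix) : PackedMatrix := L.foldr diagSum empty

theorem weight_empty : empty.weight = 0 := rfl

theorem weight_diagProd (L : List PackedMatrix) :
    (diagProd L).weight = (L.map weight).sum := by
  induction L with
  | nil => rfl
  | cons M L ih =>
    have h : diagProd (M :: L) = M.diagSum (diagProd L) := rfl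
    rw [h, weight_diagSum, ih, List.map_cons, List.sum_cons]

theorem weight_eq_zero_iff (M : PackedMatrix) : M.weight = 0 ↔ M = empty := by
  constructor
  · intro h
    have h1 := M.row_le_weight
    have h2 := M.col_le_weight
    rw [h] at h1 h2
    obtain ⟨r, c, e, hr, hc⟩ := M
    obtain rfl : r = 0 := Nat.le_zero.mp h1
    obtain rfl : c = 0 := Nat.le_zero.mp h2
    have : e = 0 := by ext i; exact i.elim0
    subst this
    rfl
  · rintro rfl
    rfl

theorem finite_splittings (M : PackedMatrix) :
    {p : PackedMatrix × PackedMatrix | p.1.diagSum p.2 = M}.Finite := by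
  refine ((finite_weight_le M.weight).prod (finite_weight_le M.weight)).subset ?_
  rintro ⟨A, B⟩ h
  have h' : A.weight + B.weight = M.weight := by rw [← weight_diagSum]; exact congrArg weight h
  exact ⟨show A.weight ≤ M.weight by omega, show B.weight ≤ M.weight by omega⟩

/-- The pairs `(M', M'')` of packed matrices with `M = M' ↘ M''`. -/
def splittings (M : PackedMatrix) : Finset (PackedMatrix × PackedMatrix) :=
  (finite_splittings M).toFinset

@[simp] theorem mem_splittings {M : PackedMatrix} {p : PackedMatrix × PackedMatrix} :
    p ∈ M.splittings ↔ p.1.diagSum p.2 = M := by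
  simp [splittings]

theorem finite_decompositions (M : PackedMatrix) :
    {L : List PackedMatrix | (∀ N ∈ L, N ≠ empty) ∧ diagProd L = M}.Finite := by
  have hfin : Finite {N : PackedMatrix // N.weight ≤ M.weight} := finite_weight_le M.weight
  have h := (List.finite_length_le {N : PackedMatrix // N.weight ≤ M.weight} M.weight).image
    (List.map Subtype.val)
  refine h.subset ?_
  rintro L ⟨hL, hM⟩
  have hw : (L.map weight).sum = M.weight := by rw [← weight_diagProd, hM]
  have hle : ∀ N ∈ L, N.weight ≤ M.weight := by
    intro N hN
    rw [← hw]
    exact List.single_le_sum (by simp) _ (List.mem_map_of_mem hN)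
  have hlen : L.length ≤ M.weight := by
    rw [← hw]
    have h1 : ∀ n ∈ L.map weight, 1 ≤ n := by
      intro n hn
      obtain ⟨N, hN, rfl⟩ := List.mem_map.mp hn
      exact Nat.pos_of_ne_zero fun h0 => hL N hN ((weight_eq_zero_iff N).mp h0)
    simpa using List.length_le_sum_of_one_le (L.map weight) h1
  refine ⟨L.attach.map fun N => ⟨N.1, hle N.1 N.2⟩, by simpa using hlen, ?_⟩
  simp [List.map_map, Function.comp_def]

/-- The sequences `(M₁, …, M_k)`, `k ≥ 0`, of nonempty packed matrices with
`M = M₁ ↘ ⋯ ↘ M_k`. -/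
def decompositions (M : PackedMatrix) : Finset (List PackedMatrix) :=
  (finite_decompositions M).toFinset

@[simp] theorem mem_decompositions {M : PackedMatrix} {L : List PackedMatrix} :
    L ∈ M.decompositions ↔ (∀ N ∈ L, N ≠ empty) ∧ diagProd L = M := by
  simp [decompositions]

/-- The matrix `μ(α)` of a map `α : [k] → [l]`, with entries `δ_{i, α(j)}`. -/
def mapMatrix {k l : ℕ} (α : Fin k → Fin l) : Matrix (Fin l) (Fin k) ℕ :=
  Matrix.of fun i j => if i = α j then 1 else 0

theorem mapMatrix_mul_mul_apply {k l k' l' : ℕ} (A : Matrix (Fin k) (Fin l) ℕ)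
    (σ : Fin k → Fin k') (τ : Fin l → Fin l') (i : Fin k') (j : Fin l') :
    (mapMatrix σ * A * (mapMatrix τ)ᵀ) i j =
      ∑ b, ∑ a, if i = σ a ∧ j = τ b then A a b else 0 := by
  simp only [Matrix.mul_apply, mapMatrix, Matrix.transpose_apply, Matrix.of_apply,
    Finset.sum_mul]
  refine Finset.sum_congr rfl fun b _ => Finset.sum_congr rfl fun a _ => ?_
  by_cases h1 : i = σ a <;> by_cases h2 : j = τ b <;> simp [h1, h2]

theorem mapMatrix_mul_mul_ne_zero {k l k' l' : ℕ} {A : Matrix (Fin k) (Fin l) ℕ}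
    (σ : Fin k → Fin k') (τ : Fin l → Fin l') {a : Fin k} {b : Fin l} (h : A a b ≠ 0) :
    (mapMatrix σ * A * (mapMatrix τ)ᵀ) (σ a) (τ b) ≠ 0 := by
  rw [mapMatrix_mul_mul_apply]
  intro h0
  rw [Finset.sum_eq_zero_iff] at h0
  have h1 := Finset.sum_eq_zero_iff.mp (h0 b (Finset.mem_univ b)) a (Finset.mem_univ a)
  simp at h1
  exact h h1

/-- The packed matrix `μ(σ) M μ(τ)ᵀ`, for surjective maps `σ` and `τ`. -/
def merge (M : PackedMatrix) {k l : ℕ} (σ : Fin M.row → Fin k) (τ : Fin M.col → Fin l)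
    (hσ : Function.Surjective σ) (hτ : Function.Surjective τ) : PackedMatrix where
  row := k
  col := l
  entry := mapMatrix σ * M.entry * (mapMatrix τ)ᵀ
  row_ne_zero i := by
    obtain ⟨a, rfl⟩ := hσ i
    obtain ⟨b, hb⟩ := M.row_ne_zero a
    exact ⟨τ b, mapMatrix_mul_mul_ne_zero σ τ hb⟩
  col_ne_zero j := by
    obtain ⟨b, rfl⟩ := hτ j
    obtain ⟨a, ha⟩ := M.col_ne_zero b
    exact ⟨σ a, mapMatrix_mul_mul_ne_zero σ τ ha⟩

/-- The composition of the row sums. -/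
def rowSums (M : PackedMatrix) : List ℕ+ :=
  List.ofFn fun i => ⟨∑ j, M.entry i j, M.sum_row_pos i⟩

/-- The composition of the column sums. -/
def colSums (M : PackedMatrix) : List ℕ+ :=
  List.ofFn fun j => ⟨∑ i, M.entry i j, M.sum_col_pos j⟩

/-- The composition obtained by reading the entries row by row, from left to right in each row,
and deleting the zeros. -/
def reading (M : PackedMatrix) : List ℕ+ :=
  (List.ofFn fun i => List.ofFn fun j => M.entry i j).flatten.filterMap
    fun n => if h : 0 < n then some ⟨n, h⟩ else none

/-- `M` is a (square) diagonal matrix. The empty matrix is diagonal. -/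
def IsDiagonal (M : PackedMatrix) : Prop :=
  M.row = M.col ∧ ∀ (i : Fin M.row) (j : Fin M.col), (i : ℕ) ≠ (j : ℕ) → M.entry i j = 0

theorem IsDiagonal.entry_pos {M : PackedMatrix} (h : M.IsDiagonal) (i : Fin M.row) :
    0 < M.entry i (Fin.cast h.1 i) := by
  obtain ⟨j, hj⟩ := M.row_ne_zero i
  have hij : (i : ℕ) = (j : ℕ) := by
    by_contra hne
    exact hj (h.2 i j hne)
  have : j = Fin.cast h.1 i := Fin.ext (by simp [hij])
  subst this
  exact Nat.pos_of_ne_zero hj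

/-- The composition `(m₁₁, …, m_kk)` of the diagonal entries of a diagonal packed matrix. -/
def diag (M : PackedMatrix) (h : M.IsDiagonal) : List ℕ+ :=
  List.ofFn fun i : Fin M.row => ⟨M.entry i (Fin.cast h.1 i), h.entry_pos i⟩

end PackedMatrix

/-! ### Quasi-shuffles and admissible pairs -/

/-- `(k, l)`-quasi-shuffles: surjections `σ : [k + l] → [n]` (so `n ≤ k + l`) that are strictly
increasing on the first `k` and on the last `l` elements. -/
def QuasiShuffle (k l : ℕ) : Type :=
  Σ n : Fin (k + l + 1), {σ : Fin (k + l) → Fin n // Function.Surjective σ ∧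
    StrictMono (fun i : Fin k => σ (Fin.castAdd l i)) ∧
    StrictMono (fun j : Fin l => σ (Fin.natAdd k j))}

instance (k l : ℕ) : Fintype (QuasiShuffle k l) := by
  classical
  unfold QuasiShuffle
  infer_instance

/-- The set `Adm(k)` of pairs of surjections `σ' : [k] → [k']` and `σ'' : [k] → [k'']`
(so `k', k'' ≤ k`) such that `σ'` is weakly increasing and `σ''` is strictly increasing on each
fibre of `σ'`. -/
def Adm (k : ℕ) : Type :=
  Σ n : Fin (k + 1) × Fin (k + 1), {s : (Fin k → Fin n.1) × (Fin k → Fin n.2) //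
    Function.Surjective s.1 ∧ Function.Surjective s.2 ∧ Monotone s.1 ∧
    ∀ i j, i < j → s.1 i = s.1 j → s.2 i < s.2 j}

instance (k : ℕ) : Fintype (Adm k) := by
  classical
  unfold Adm
  infer_instance

/-! ### The structure maps of the two double bialgebras -/

/-- Product, unit, coproduct `Δ` and its counit, second coproduct `δ` and its counit. -/
structure DoubleBialgebraMaps (A : Type*) [AddCommGroup A] [Module ℚ A] where
  mul : A →ₗ[ℚ] A →ₗ[ℚ] A
  one : A
  comul : A →ₗ[ℚ] A ⊗[ℚ] A
  counit : A →ₗ[ℚ] ℚ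
  comul₂ : A →ₗ[ℚ] A ⊗[ℚ] A
  counit₂ : A →ₗ[ℚ] ℚ

/-- `f` is a morphism of bialgebras for the product and the coproduct `Δ`. -/
structure IsBialgebraMorphism {A B : Type*} [AddCommGroup A] [Module ℚ A] [AddCommGroup B]
    [Module ℚ B] (SA : DoubleBialgebraMaps A) (SB : DoubleBialgebraMaps B)
    (f : A →ₗ[ℚ] B) : Prop where
  map_mul : ∀ a b, f (SA.mul a b) = SB.mul (f a) (f b)
  map_one : f SA.one = SB.one
  map_comul : ∀ a, SB.comul (f a) = TensorProduct.map f f (SA.comul a)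
  map_counit : ∀ a, SB.counit (f a) = SA.counit a

/-- `f` is a morphism of double bialgebras: it is a bialgebra morphism that is also compatible
with the second coproduct and its counit. -/
structure IsDoubleBialgebraMorphism {A B : Type*} [AddCommGroup A] [Module ℚ A] [AddCommGroup B]
    [Module ℚ B] (SA : DoubleBialgebraMaps A) (SB : DoubleBialgebraMaps B)
    (f : A →ₗ[ℚ] B) : Prop extends IsBialgebraMorphism SA SB f where
  map_comul₂ : ∀ a, SB.comul₂ (f a) = TensorProduct.map f f (SA.comul₂ a)
  map_counit₂ : ∀ a, SB.counit₂ (f a) = SA.counit₂ a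

/-- The space `H_Pack` with basis the set of packed matrices. -/
abbrev HPack : Type := PackedMatrix →₀ ℚ

namespace HPack

/-- The basis element of a packed matrix. -/
abbrev basis (M : PackedMatrix) : HPack := Finsupp.single M 1

/-- The quasi-shuffle product: the sum of the `μ(σ) (M ↘ N) μ(τ)ᵀ` over all quasi-shuffles `σ` of
the rows and `τ` of the columns. -/
def mul : HPack →ₗ[ℚ] HPack →ₗ[ℚ] HPack :=
  Finsupp.linearCombination ℚ fun M => Finsupp.linearCombination ℚ fun N =>
    ∑ σ : QuasiShuffle M.row N.row, ∑ τ : QuasiShuffle M.col N.col,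
      basis ((M.diagSum N).merge σ.2.1 τ.2.1 σ.2.2.1 τ.2.2.1)

/-- The coproduct `Δ(M) = ∑ M' ⊗ M''` over all `M = M' ↘ M''`. -/
def comul : HPack →ₗ[ℚ] HPack ⊗[ℚ] HPack :=
  Finsupp.linearCombination ℚ fun M => ∑ p ∈ M.splittings, basis p.1 ⊗ₜ[ℚ] basis p.2

open Classical in
/-- The counit of `Δ`: the coefficient of the empty matrix. -/
def counit : HPack →ₗ[ℚ] ℚ :=
  Finsupp.linearCombination ℚ fun M => if M = PackedMatrix.empty then 1 else 0

/-- The second coproduct `δ`. -/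
def comul₂ : HPack →ₗ[ℚ] HPack ⊗[ℚ] HPack :=
  Finsupp.linearCombination ℚ fun M => ∑ σ : Adm M.row, ∑ τ : Adm M.col,
    basis (M.merge σ.2.1.1 τ.2.1.1 σ.2.2.1 τ.2.2.1) ⊗ₜ[ℚ]
      basis (M.merge σ.2.1.2 τ.2.1.2 σ.2.2.2.1 τ.2.2.2.1)

open Classical in
/-- The counit of `δ`: it is `1` on the empty matrix and on `1 × 1` matrices, `0` on the other
packed matrices. -/
def counit₂ : HPack →ₗ[ℚ] ℚ :=
  Finsupp.linearCombination ℚ fun M =>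
    if M = PackedMatrix.empty ∨ (M.row = 1 ∧ M.col = 1) then 1 else 0

/-- The structure maps of the double bialgebra `H_Pack`. -/
def structureMaps : DoubleBialgebraMaps HPack where
  mul := mul
  one := basis PackedMatrix.empty
  comul := comul
  counit := counit
  comul₂ := comul₂
  counit₂ := counit₂

end HPack

/-- Quasi-symmetric functions, with the monomial basis indexed by compositions, that is, by finite
sequences of positive integers. -/
abbrev QSym : Type := List ℕ+ →₀ ℚ

namespace QSym

/-- The basis element of a composition. -/
abbrev basis (a : List ℕ+) : QSym := Finsupp.single a 1

theorem sum_fibre_pos {m n : ℕ} (a : Fin m → ℕ+) (σ : Fin m → Fin n)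
    (hσ : Function.Surjective σ) (p : Fin n) :
    0 < ∑ i, if σ i = p then (a i : ℕ) else 0 := by
  obtain ⟨i, rfl⟩ := hσ p
  refine lt_of_lt_of_le (a i).pos ?_
  have := Finset.single_le_sum (f := fun j => if σ j = σ i then (a j : ℕ) else 0)
    (fun _ _ => Nat.zero_le _) (Finset.mem_univ i)
  simpa using this

/-- The composition `(∑_{σ(i)=1} a_i, …, ∑_{σ(i)=n} a_i)`. -/
def collapse {m n : ℕ} (a : Fin m → ℕ+) (σ : Fin m → Fin n)
    (hσ : Function.Surjective σ) : List ℕ+ :=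
  List.ofFn fun p => ⟨∑ i, if σ i = p then (a i : ℕ) else 0, sum_fibre_pos a σ hσ p⟩

/-- The quasi-shuffle product of compositions. -/
def mul : QSym →ₗ[ℚ] QSym →ₗ[ℚ] QSym :=
  Finsupp.linearCombination ℚ fun a => Finsupp.linearCombination ℚ fun b =>
    ∑ σ : QuasiShuffle a.length b.length,
      basis (collapse (Fin.append a.get b.get) σ.2.1 σ.2.2.1)

/-- The deconcatenation coproduct `Δ`. -/
def comul : QSym →ₗ[ℚ] QSym ⊗[ℚ] QSym :=
  Finsupp.linearCombination ℚ fun a =>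
    ∑ k ∈ Finset.range (a.length + 1), basis (a.take k) ⊗ₜ[ℚ] basis (a.drop k)

/-- The counit of `Δ`: the coefficient of the empty composition. -/
def counit : QSym →ₗ[ℚ] ℚ :=
  Finsupp.linearCombination ℚ fun a => if a = [] then 1 else 0

/-- The second coproduct `δ`, dual to the product of the descent algebras
`D_β ∘ D_γ = ∑ D_{ω(ν)}`, the sum being over the matrices `ν` of natural numbers with row sums `β`
and column sums `γ`, where `ω(ν)` is the reading of `ν` without its zeros. As `β` and `γ` have
positive parts, such a `ν` is packed; so `δ(a)` is the sum of `r(ν) ⊗ c(ν)` over the packed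
matrices `ν` (necessarily of weight `|a|`) with reading `a`. -/
def comul₂ : QSym →ₗ[ℚ] QSym ⊗[ℚ] QSym :=
  Finsupp.linearCombination ℚ fun a =>
    ∑ ν ∈ PackedMatrix.ofWeight (a.map fun n : ℕ+ => (n : ℕ)).sum with ν.reading = a,
      basis ν.rowSums ⊗ₜ[ℚ] basis ν.colSums

/-- The counit of `δ`: it is `1` on compositions with at most one part, and `0` on the others. -/
def counit₂ : QSym →ₗ[ℚ] ℚ :=
  Finsupp.linearCombination ℚ fun a => if a.length ≤ 1 then 1 else 0

/-- The structure maps of the double bialgebra `QSym`. -/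
def structureMaps : DoubleBialgebraMaps QSym where
  mul := mul
  one := basis []
  comul := comul
  counit := counit
  comul₂ := comul₂
  counit₂ := counit₂

end QSym

/-! ### The morphisms `K_{x,y}` and `κ_{x,y}` -/

/-- The value at `x` of the Hilbert polynomial `H_n(X) = X (X - 1) ⋯ (X - n + 1) / n!`. -/
def hilbertPoly (n : ℕ) (x : ℚ) : ℚ :=
  (∏ i ∈ Finset.range n, (x - i)) / (n.factorial : ℚ)

/-- The space of noncommutative symmetric functions, with basis the set of compositions (packed
row matrices). -/
abbrev NSym : Type := List ℕ+ →₀ ℚ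

/-- The map `K_{x,y}` from noncommutative symmetric functions to `H_Pack`: the composition
`(a₁, …, a_n)` is sent to the sum, over the sequences `(M₁, …, M_n)` of packed matrices with
`ω(M_i) = a_i`, of `(∏ H_{row(M_i)}(x) H_{col(M_i)}(y)) M₁ ↘ ⋯ ↘ M_n`. -/
def bigK (x y : ℚ) : NSym →ₗ[ℚ] HPack :=
  Finsupp.linearCombination ℚ fun a =>
    ∑ M ∈ Fintype.piFinset fun i : Fin a.length => PackedMatrix.ofWeight (a.get i),
      (∏ i, hilbertPoly (M i).row x * hilbertPoly (M i).col y) •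
        HPack.basis (PackedMatrix.diagProd (List.ofFn M))

/-- The composition `(ω(M₁), …, ω(M_k))` of a sequence of nonempty packed matrices. -/
def weights (L : List PackedMatrix) (hL : ∀ N ∈ L, N ≠ PackedMatrix.empty) : List ℕ+ :=
  L.pmap (fun N hN => ⟨N.weight, Nat.pos_of_ne_zero fun h => hN (N.weight_eq_zero_iff.mp h)⟩) hL

/-- The map `κ_{x,y}` from `H_Pack` to `QSym`: the packed matrix `M` is sent to the sum, over its
decompositions `M = M₁ ↘ ⋯ ↘ M_k` into nonempty packed matrices, of
`(∏ H_{row(M_i)}(x) H_{col(M_i)}(y)) (ω(M₁), …, ω(M_k))`. -/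
def kappa (x y : ℚ) : HPack →ₗ[ℚ] QSym :=
  Finsupp.linearCombination ℚ fun M => ∑ L ∈ M.decompositions.attach,
    (L.1.map fun N => hilbertPoly N.row x * hilbertPoly N.col y).prod •
      QSym.basis (weights L.1 (PackedMatrix.mem_decompositions.mp L.2).1)

end

/-! Let `λ(M) = H_{row(M)}(x) H_{col(M)}(y)`. The map `κ_{x,y}` is obtained from `λ` by the usual
construction of morphisms into QSym: cut `M` along the diagonal in all possible ways, evaluate `λ`
on each nonempty block and record the weights of the blocks. Duality with `K_{x,y}` and
compatibility with `Δ` only involve lists of blocks: both sides of the duality run over the same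
lists, and cutting a list in two corresponds to splitting `M` and decomposing both pieces
(`bigK_basis_apply`, `kappa_comul`).

Multiplicativity rests on `λ` being a character, that is, on `H_k(x) H_l(x) = ∑ H_{max σ}(x)` over
the `(k,l)`-quasi-shuffles `σ`. For a natural number `x` both sides count pairs of a `k`-subset and
an `l`-subset of `[x]`, the right side sorting them by the size and relative position of their
union. The identity is polynomial in `x`, hence holds over the rationals (`sum_words_hilbertPoly`).
To pass from `λ` to `κ`, let `behead n` remove a first part `n` from compositions and, on packed
matrices, a first block of weight `n` with coefficient `λ`. Both operators satisfy `behead n (A B) =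
∑_{i+j=n} behead i A · behead j B`, and `κ` intertwines them (`behead_kappa`). On matrices the
formula combines multiplicativity of `Δ` (`sum_splittings_wordMerge`), that of `λ`, and additivity
of the weight. As `behead` reads off coefficients, `kappa_mul` follows by induction on the
composition.

At `x = y = 1`, `H_n(1)` vanishes for `n ≥ 2`, so only decompositions into `1 × 1` blocks survive
and `κ_{1,1}` extracts the diagonal. Conversely, the counit of `δ` takes the value `λ(M)` on
`κ_{x,y}(M)` for `M` nonempty, and three small sizes force `x = y = 1`.

For `δ`, an admissible pair is the same as a strictly increasing family of positions `(σ'(i),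
σ''(i))` in lexicographic order, with both coordinates surjective. If both tensor factors of the
term of `δ(M)` indexed by `(σ, τ)` are diagonal, each nonzero entry `(i, j)` of `M` satisfies `σ.pos
i = τ.pos j`. The two increasing families then have equal ranges, so they coincide and `M` is
diagonal. For `M` diagonal exactly the terms `σ = τ` survive. On the QSym side, listing the
positions of the nonzero entries identifies the matrices with reading `a` with the admissible pairs,
which gives the same sum. -/

noncomputable section

open PackedMatrix

/-! ### Packed matrices as a monoid under diagonal sum -/

namespace PackedMatrix

/-- The entries of a packed matrix, extended by zero to all pairs of natural numbers. -/
def get (M : PackedMatrix) (i j : ℕ) : ℕ :=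
  if h : i < M.row ∧ j < M.col then M.entry ⟨i, h.1⟩ ⟨j, h.2⟩ else 0

theorem get_val (M : PackedMatrix) (i : Fin M.row) (j : Fin M.col) :
    M.get i j = M.entry i j := by
  simp [get]

theorem get_ne_zero {M : PackedMatrix} {i j : ℕ} (h : M.get i j ≠ 0) : i < M.row ∧ j < M.col := by
  by_contra h'
  exact h (dif_neg h')

theorem get_of_row_le {M : PackedMatrix} {i : ℕ} (j : ℕ) (h : M.row ≤ i) : M.get i j = 0 := by
  by_contra h'
  have := get_ne_zero h'
  omega

theorem get_of_col_le {M : PackedMatrix} (i : ℕ) {j : ℕ} (h : M.col ≤ j) : M.get i j = 0 := by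
  by_contra h'
  have := get_ne_zero h'
  omega

theorem ext_get {M N : PackedMatrix} (hr : M.row = N.row) (hc : M.col = N.col)
    (h : ∀ i j, M.get i j = N.get i j) : M = N := by
  obtain ⟨r, c, e, h1, h2⟩ := M
  obtain ⟨r', c', e', h1', h2'⟩ := N
  dsimp only at hr hc
  subst hr hc
  congr
  ext i j
  have := h i j
  simpa [get] using this

theorem exists_get_row (M : PackedMatrix) {i : ℕ} (hi : i < M.row) : ∃ j, M.get i j ≠ 0 := by
  obtain ⟨j, hj⟩ := M.row_ne_zero ⟨i, hi⟩
  exact ⟨j, by simpa [get, hi] using hj⟩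

theorem exists_get_col (M : PackedMatrix) {j : ℕ} (hj : j < M.col) : ∃ i, M.get i j ≠ 0 := by
  obtain ⟨i, hi⟩ := M.col_ne_zero ⟨j, hj⟩
  exact ⟨i, by simpa [get, hj] using hi⟩

theorem get_empty (i j : ℕ) : empty.get i j = 0 := get_of_row_le j (Nat.zero_le i)

theorem get_diagSum (M N : PackedMatrix) (i j : ℕ) :
    (M.diagSum N).get i j = M.get i j +
      if M.row ≤ i ∧ M.col ≤ j then N.get (i - M.row) (j - M.col) else 0 := by
  by_cases h : i < M.row + N.row ∧ j < M.col + N.col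
  · obtain ⟨h1, h2⟩ := h
    have key : ∀ (a : Fin (M.row + N.row)) (b : Fin (M.col + N.col)),
        (M.diagSum N).get a b = M.get a b +
          if M.row ≤ a ∧ M.col ≤ b then N.get (a - M.row) (b - M.col) else 0 := by
      intro a b
      rw [show (M.diagSum N).get a b = (M.diagSum N).entry a b from get_val (M.diagSum N) a b]
      obtain ⟨a, rfl⟩ := finSumFinEquiv.surjective a
      obtain ⟨b, rfl⟩ := finSumFinEquiv.surjective b
      have ha : ∀ x : Fin M.row, ¬ M.row ≤ (x : ℕ) := fun x => by omega
      have hb : ∀ x : Fin M.col, ¬ M.col ≤ (x : ℕ) := fun x => by omega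
      rcases a with a | a <;> rcases b with b | b <;>
        simp [diagSum, get_val, ha, hb, get_of_row_le, get_of_col_le]
    exact key ⟨i, h1⟩ ⟨j, h2⟩
  · rw [show (M.diagSum N).get i j = 0 from dif_neg h]
    by_cases h1 : M.row + N.row ≤ i
    · rw [get_of_row_le j (by omega : M.row ≤ i), get_of_row_le _ (by omega)]; simp
    · rw [get_of_col_le i (by omega : M.col ≤ j), get_of_col_le (M := N) _ (by omega)]; simp

theorem diagSum_row (M N : PackedMatrix) : (M.diagSum N).row = M.row + N.row := rfl
theorem diagSum_col (M N : PackedMatrix) : (M.diagSum N).col = M.col + N.col := rfl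

theorem diagSum_assoc (A B C : PackedMatrix) :
    (A.diagSum B).diagSum C = A.diagSum (B.diagSum C) := by
  refine ext_get (by simp [diagSum_row, add_assoc]) (by simp [diagSum_col, add_assoc]) ?_
  intro i j
  simp only [get_diagSum, diagSum_row, diagSum_col, Nat.sub_sub]
  have h1 : (A.row + B.row ≤ i ∧ A.col + B.col ≤ j) ↔ (A.row ≤ i ∧ A.col ≤ j) ∧
      (B.row ≤ i - A.row ∧ B.col ≤ j - A.col) := by omega
  by_cases h2 : A.row ≤ i ∧ A.col ≤ j
  · simp only [h1, h2, true_and, add_assoc, if_true, and_self]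
  · simp only [h1, h2, false_and, if_false, add_zero]

theorem empty_diagSum (M : PackedMatrix) : empty.diagSum M = M := by
  refine ext_get (by simp [diagSum_row, empty]) (by simp [diagSum_col, empty]) ?_
  intro i j
  rw [get_diagSum, get_empty]
  simp [empty]

theorem diagSum_empty (M : PackedMatrix) : M.diagSum empty = M := by
  refine ext_get (by simp [diagSum_row, empty]) (by simp [diagSum_col, empty]) ?_
  intro i j
  rw [get_diagSum, get_empty]
  simp

theorem diagSum_inj {A B A' B' : PackedMatrix} (h : A.diagSum B = A'.diagSum B')
    (hr : A.row = A'.row) (hc : A.col = A'.col) : A = A' ∧ B = B' := by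
  have hget : ∀ i j, (A.diagSum B).get i j = (A'.diagSum B').get i j := fun i j => by rw [h]
  have hr' : A.row + B.row = A'.row + B'.row := congrArg row h
  have hc' : A.col + B.col = A'.col + B'.col := congrArg col h
  simp only [get_diagSum] at hget
  constructor
  · refine ext_get hr hc fun i j => ?_
    by_cases h1 : A.row ≤ i ∨ A.col ≤ j
    · rcases h1 with h1 | h1
      · rw [get_of_row_le j h1, get_of_row_le j (hr ▸ h1)]
      · rw [get_of_col_le i h1, get_of_col_le i (hc ▸ h1)]
    · have := hget i j
      rwa [if_neg (by omega), if_neg (by omega)] at this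
  · refine ext_get (by omega) (by omega) fun i j => ?_
    have := hget (i + A.row) (j + A.col)
    rw [if_pos (by omega), if_pos (by omega), get_of_row_le _ (by omega),
      get_of_row_le (M := A') _ (by omega)] at this
    simpa [hr, hc] using this

theorem get_diagSum_ne_zero {A B : PackedMatrix} {i j : ℕ} (h : (A.diagSum B).get i j ≠ 0) :
    i < A.row ↔ j < A.col := by
  rw [get_diagSum] at h
  by_contra h'
  apply h
  rw [if_neg (by omega)]
  by_cases h1 : i < A.row
  · rw [get_of_col_le i (Nat.le_of_not_lt fun h2 => h' (by simp [h1, h2]))]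
  · rw [get_of_row_le j (by omega)]

/-- The packed matrix with prescribed size and entries. -/
def ofGet (r c : ℕ) (f : ℕ → ℕ → ℕ) (hr : ∀ i < r, ∃ j < c, f i j ≠ 0)
    (hc : ∀ j < c, ∃ i < r, f i j ≠ 0) : PackedMatrix where
  row := r
  col := c
  entry := Matrix.of fun i j => f i j
  row_ne_zero i := by
    obtain ⟨j, hj, h⟩ := hr i i.2
    exact ⟨⟨j, hj⟩, h⟩
  col_ne_zero j := by
    obtain ⟨i, hi, h⟩ := hc j j.2
    exact ⟨⟨i, hi⟩, h⟩

theorem get_ofGet (r c : ℕ) (f : ℕ → ℕ → ℕ) (hr hc) (i j : ℕ) :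
    (ofGet r c f hr hc).get i j = if i < r ∧ j < c then f i j else 0 := by
  rfl

/-- A packed matrix whose entries vanish outside two diagonal blocks splits accordingly. -/
theorem exists_diagSum_eq (M : PackedMatrix) {r c : ℕ} (hr : r ≤ M.row) (hc : c ≤ M.col)
    (h : ∀ i j, M.get i j ≠ 0 → (i < r ↔ j < c)) :
    ∃ A B : PackedMatrix, A.diagSum B = M ∧ A.row = r ∧ A.col = c := by
  have hA1 : ∀ i < r, ∃ j < c, M.get i j ≠ 0 := fun i hi => by
    obtain ⟨j, hj⟩ := M.exists_get_row (hi.trans_le hr)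
    exact ⟨j, (h i j hj).mp hi, hj⟩
  have hA2 : ∀ j < c, ∃ i < r, M.get i j ≠ 0 := fun j hj => by
    obtain ⟨i, hi⟩ := M.exists_get_col (hj.trans_le hc)
    exact ⟨i, (h i j hi).mpr hj, hi⟩
  have hB1 : ∀ i < M.row - r, ∃ j < M.col - c, M.get (r + i) (c + j) ≠ 0 := fun i hi => by
    obtain ⟨j, hj⟩ := M.exists_get_row (i := r + i) (by omega)
    have h1 := h _ _ hj
    have h2 := (get_ne_zero hj).2
    exact ⟨j - c, by omega, by rwa [show c + (j - c) = j by omega]⟩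
  have hB2 : ∀ j < M.col - c, ∃ i < M.row - r, M.get (r + i) (c + j) ≠ 0 := fun j hj => by
    obtain ⟨i, hi⟩ := M.exists_get_col (j := c + j) (by omega)
    have h1 := h _ _ hi
    have h2 := (get_ne_zero hi).1
    exact ⟨i - r, by omega, by rwa [show r + (i - r) = i by omega]⟩
  refine ⟨ofGet r c M.get hA1 hA2, ofGet _ _ (fun i j => M.get (r + i) (c + j)) hB1 hB2,
    ext_get ?_ ?_ fun i j => ?_, rfl, rfl⟩
  · change r + (M.row - r) = _
    omega
  · change c + (M.col - c) = _
    omega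
  · rw [get_diagSum, get_ofGet, get_ofGet]
    change (if i < r ∧ j < c then M.get i j else 0) + (if r ≤ i ∧ c ≤ j then
      (if i - r < M.row - r ∧ j - c < M.col - c then M.get (r + (i - r)) (c + (j - c)) else 0)
        else 0) = _
    by_cases h0 : M.get i j = 0
    · split_ifs with h1 h2 h3 h4 <;> first | omega | skip
      rw [show r + (i - r) = i by omega, show c + (j - c) = j by omega]
      omega
    · have h1 := h i j h0
      have h2 := get_ne_zero h0
      by_cases h3 : i < r
      · rw [if_pos (by omega), if_neg (by omega), add_zero]
      · rw [if_neg (by omega), if_pos (by omega), if_pos (by omega),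
          show r + (i - r) = i by omega, show c + (j - c) = j by omega, zero_add]

theorem diagProd_nil : diagProd [] = empty := rfl

theorem diagProd_cons (M : PackedMatrix) (L : List PackedMatrix) :
    diagProd (M :: L) = M.diagSum (diagProd L) := rfl

theorem diagProd_append (L L' : List PackedMatrix) :
    diagProd (L ++ L') = (diagProd L).diagSum (diagProd L') := by
  induction L with
  | nil => rw [List.nil_append, diagProd_nil, empty_diagSum]
  | cons M L ih => rw [List.cons_append, diagProd_cons, ih, diagProd_cons, diagSum_assoc]

theorem diagSum_eq_empty {A B : PackedMatrix} : A.diagSum B = empty ↔ A = empty ∧ B = empty := by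
  rw [← weight_eq_zero_iff, weight_diagSum, ← weight_eq_zero_iff, ← weight_eq_zero_iff]
  omega

theorem decompositions_empty : empty.decompositions = {[]} := by
  ext L
  rw [mem_decompositions, Finset.mem_singleton]
  constructor
  · rintro ⟨h1, h2⟩
    cases L with
    | nil => rfl
    | cons M L => exact absurd (diagSum_eq_empty.mp h2).1 (h1 M (by simp))
  · rintro rfl
    simp [diagProd_nil]

/-- The weight of a packed matrix, as a positive integer (`1` for the empty matrix). -/
def pweight (M : PackedMatrix) : ℕ+ := M.weight.toPNat'

theorem pweight_coe {M : PackedMatrix} (h : M ≠ empty) : (M.pweight : ℕ) = M.weight := by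
  rw [pweight, Nat.toPNat'_coe, if_pos]
  exact Nat.pos_of_ne_zero fun h0 => h (M.weight_eq_zero_iff.mp h0)

/-- This frees the composition of weights from its proof argument. The default value of `pweight` on
the empty matrix is harmless, since no block of `L` is empty. -/
theorem weights_eq_map (L : List PackedMatrix) (hL : ∀ N ∈ L, N ≠ empty) :
    weights L hL = L.map pweight := by
  rw [weights, ← List.pmap_eq_map (p := fun N => N ≠ empty) (H := hL)]
  refine List.pmap_congr_left L fun N hN h1 _ => ?_
  exact PNat.coe_injective (pweight_coe h1).symm

/-- The factor `H_{row(M)}(x) H_{col(M)}(y)` of a packed matrix. -/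
def hilbertWeight (x y : ℚ) (M : PackedMatrix) : ℚ :=
  hilbertPoly M.row x * hilbertPoly M.col y

end PackedMatrix

/-! ### Coefficients of `κ` and its duality with `K` -/

theorem hilbertPoly_zero (x : ℚ) : hilbertPoly 0 x = 1 := by simp [hilbertPoly]

theorem hilbertWeight_empty (x y : ℚ) : hilbertWeight x y empty = 1 := by
  simp [hilbertWeight, empty, hilbertPoly_zero]

theorem kappa_basis (x y : ℚ) (M : PackedMatrix) :
    kappa x y (HPack.basis M) = ∑ L ∈ M.decompositions,
      (L.map (hilbertWeight x y)).prod • QSym.basis (L.map pweight) := by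
  rw [kappa, Finsupp.linearCombination_single, one_smul, ← Finset.sum_attach M.decompositions]
  refine Finset.sum_congr rfl fun L _ => ?_
  rw [weights_eq_map]
  rfl

theorem kappa_empty (x y : ℚ) : kappa x y (HPack.basis empty) = QSym.basis [] := by
  simp [kappa_basis, decompositions_empty]

theorem kappa_basis_apply (x y : ℚ) (M : PackedMatrix) (a : List ℕ+) :
    kappa x y (HPack.basis M) a =
      ∑ L ∈ M.decompositions with L.map pweight = a, (L.map (hilbertWeight x y)).prod := by
  rw [kappa_basis, Finsupp.finsetSum_apply, Finset.sum_filter]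
  refine Finset.sum_congr rfl fun L _ => ?_
  simp [Finsupp.single_apply]

/-- The parts of `a` are positive, so the matrices occurring in `K(a)` are nonempty; the families
with diagonal sum `M` are therefore the decompositions of `M` with weights `a`. The right side is
that of `kappa_basis_apply`, whence the duality. -/
theorem bigK_basis_apply (x y : ℚ) (M : PackedMatrix) (a : List ℕ+) :
    bigK x y (Finsupp.single a 1) M =
      ∑ L ∈ M.decompositions with L.map pweight = a, (L.map (hilbertWeight x y)).prod := by
  classical
  rw [bigK, Finsupp.linearCombination_single, one_smul, Finsupp.finsetSum_apply]
  simp only [Finsupp.smul_apply, Finsupp.single_apply, smul_eq_mul, mul_ite, mul_one, mul_zero]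
  rw [← Finset.sum_filter]
  have hne : ∀ f : Fin a.length → PackedMatrix, (∀ i, (f i).weight = a.get i) →
      ∀ i, f i ≠ empty := by
    intro f hf i h
    have h1 := hf i
    rw [h, weight_empty] at h1
    exact absurd h1.symm (a.get i).ne_zero
  refine Finset.sum_bij (fun f _ => List.ofFn f) ?_ ?_ ?_ ?_
  · intro f hf
    rw [Finset.mem_filter, Fintype.mem_piFinset] at hf
    obtain ⟨h1, h2⟩ := hf
    simp only [mem_ofWeight] at h1
    rw [Finset.mem_filter, mem_decompositions]
    refine ⟨⟨?_, h2⟩, ?_⟩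
    · intro N hN
      obtain ⟨i, rfl⟩ := (List.mem_ofFn' f N).mp hN
      exact hne f h1 i
    · rw [List.map_ofFn]
      conv_rhs => rw [← List.ofFn_get a]
      congr 1
      ext i
      simp only [Function.comp_apply]
      exact PNat.coe_injective ((pweight_coe (hne f h1 i)).trans (h1 i))
  · intro f _ g _ h
    exact List.ofFn_injective h
  · intro L hL
    rw [Finset.mem_filter, mem_decompositions] at hL
    obtain ⟨⟨h1, h2⟩, rfl⟩ := hL
    refine ⟨fun i => L.get (i.cast (by simp)), ?_, ?_⟩
    · rw [Finset.mem_filter, Fintype.mem_piFinset]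
      constructor
      · intro i
        rw [mem_ofWeight]
        have := pweight_coe (h1 (L.get (i.cast (by simp))) (List.get_mem _ _))
        rw [← this]
        simp
      · rw [← h2]
        congr 1
        apply List.ext_get <;> simp
    · apply List.ext_get <;> simp
  · intro f _
    rw [List.map_ofFn, List.prod_ofFn]
    rfl

/-! ### Compatibility of `κ` with `Δ` and its counit -/

/-- A decomposition of `M` together with a place to cut it is the same as a splitting of `M`
together with a decomposition of each half. -/
theorem kappa_comul (x y : ℚ) (X : HPack) :
    QSym.comul (kappa x y X) = TensorProduct.map (kappa x y) (kappa x y) (HPack.comul X) := by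
  suffices h : QSym.comul ∘ₗ kappa x y =
      TensorProduct.map (kappa x y) (kappa x y) ∘ₗ HPack.comul from LinearMap.congr_fun h X
  refine Finsupp.lhom_ext' fun M => LinearMap.ext_ring ?_
  change QSym.comul (kappa x y (HPack.basis M)) =
    TensorProduct.map (kappa x y) (kappa x y) (HPack.comul (HPack.basis M))
  rw [HPack.comul, Finsupp.linearCombination_single, one_smul, map_sum, kappa_basis, map_sum]
  simp only [TensorProduct.map_tmul, kappa_basis, TensorProduct.sum_tmul, TensorProduct.tmul_sum,
    map_smul, QSym.comul, Finsupp.linearCombination_single, one_smul, Finset.smul_sum,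
    TensorProduct.smul_tmul_smul]
  simp only [Finset.sum_sigma']
  -- In the expanded tensor product the decomposition of the right factor is indexed before that of
  -- the left one, hence `drop` before `take`.
  refine Finset.sum_bij' (fun p _ => ⟨(diagProd (p.1.take p.2), diagProd (p.1.drop p.2)),
      p.1.drop p.2, p.1.take p.2⟩) (fun q _ => ⟨q.2.2 ++ q.2.1, q.2.2.length⟩) ?_ ?_ ?_ ?_ ?_
  · rintro ⟨L, k⟩ h
    simp only [Finset.mem_sigma, mem_decompositions, mem_splittings] at h ⊢
    obtain ⟨⟨h1, h2⟩, h3⟩ := h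
    refine ⟨?_, ⟨fun N hN => h1 N (List.mem_of_mem_drop hN), trivial⟩,
      fun N hN => h1 N (List.mem_of_mem_take hN), trivial⟩
    rw [← diagProd_append, List.take_append_drop, h2]
  · rintro ⟨⟨A, B⟩, L'', L'⟩ h
    simp only [Finset.mem_sigma, mem_decompositions, mem_splittings] at h ⊢
    obtain ⟨h1, ⟨h2, h3⟩, h4, h5⟩ := h
    refine ⟨⟨?_, ?_⟩, ?_⟩
    · intro N hN
      rcases List.mem_append.mp hN with hN | hN
      exacts [h4 N hN, h2 N hN]
    · rw [diagProd_append, h5, h3, h1]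
    · simp
  · rintro ⟨L, k⟩ h
    simp only [Finset.mem_sigma, Finset.mem_range, List.length_map] at h
    simp
    omega
  · rintro ⟨⟨A, B⟩, L'', L'⟩ h
    simp only [Finset.mem_sigma, mem_decompositions, mem_splittings] at h
    obtain ⟨h1, ⟨h2, h3⟩, h4, h5⟩ := h
    simp [h3, h5]
  · rintro ⟨L, k⟩ h
    simp only
    rw [← List.prod_append, ← List.map_append, List.take_append_drop, List.map_take, List.map_drop]

theorem kappa_counit (x y : ℚ) (X : HPack) :
    QSym.counit (kappa x y X) = HPack.counit X := by
  suffices h : QSym.counit ∘ₗ kappa x y = HPack.counit from LinearMap.congr_fun h X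
  refine Finsupp.lhom_ext' fun M => LinearMap.ext_ring ?_
  change QSym.counit (kappa x y (HPack.basis M)) = HPack.counit (HPack.basis M)
  rw [HPack.counit, Finsupp.linearCombination_single, one_smul]
  split_ifs with h
  · rw [h, kappa_empty]
    simp [QSym.counit]
  · rw [kappa_basis, map_sum]
    refine Finset.sum_eq_zero fun L hL => ?_
    have : L ≠ [] := by
      rintro rfl
      exact h (mem_decompositions.mp hL).2.symm
    simp [QSym.counit, this]

/-! ### Quasi-shuffles as words in three letters -/

/-- The letters of the words encoding quasi-shuffles: the corresponding element of the target is
hit by the left block only, by the right block only, or by both. -/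
inductive QStep
  | left
  | right
  | both

namespace QStep

/-- Whether the left block (`b = true`) or the right block (`b = false`) occurs in a letter. -/
def has : Bool → QStep → Bool
  | true, left => true
  | true, right => false
  | true, both => true
  | false, left => false
  | false, right => true
  | false, both => true

theorem ext_has {s t : QStep} (h : ∀ b, has b s = has b t) : s = t := by
  have h1 := h true
  have h2 := h false
  cases s <;> cases t <;> simp_all [has]

theorem has_or (s : QStep) : has true s = true ∨ has false s = true := by
  cases s <;> simp [has]

/-- The number of letters of a word in which a block occurs. -/
def cnt (b : Bool) (w : List QStep) : ℕ := w.countP (has b)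

/-- Whether a block occurs at a position of a word. -/
def HasAt (b : Bool) (w : List QStep) (i : ℕ) : Prop := ∃ s, w[i]? = some s ∧ has b s = true

theorem cnt_nil (b : Bool) : cnt b [] = 0 := rfl

theorem cnt_cons (b : Bool) (s : QStep) (w : List QStep) :
    cnt b (s :: w) = cnt b w + if has b s = true then 1 else 0 := List.countP_cons

theorem cnt_append (b : Bool) (u v : List QStep) : cnt b (u ++ v) = cnt b u + cnt b v :=
  List.countP_append

theorem HasAt.lt {b : Bool} {w : List QStep} {i : ℕ} (h : HasAt b w i) : i < w.length := by
  obtain ⟨s, hs, -⟩ := h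
  exact (List.getElem?_eq_some_iff.mp hs).1

theorem hasAt_append_left {b : Bool} {u : List QStep} (v : List QStep) {i : ℕ}
    (h : i < u.length) : HasAt b (u ++ v) i ↔ HasAt b u i := by
  rw [HasAt, HasAt, List.getElem?_append_left h]

theorem hasAt_append_right {b : Bool} {u : List QStep} (v : List QStep) {i : ℕ}
    (h : u.length ≤ i) : HasAt b (u ++ v) i ↔ HasAt b v (i - u.length) := by
  rw [HasAt, HasAt, List.getElem?_append_right h]

theorem cnt_take_succ (b : Bool) (w : List QStep) (i : ℕ) [Decidable (HasAt b w i)] :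
    cnt b (w.take (i + 1)) = cnt b (w.take i) + if HasAt b w i then 1 else 0 := by
  rw [List.take_add_one, cnt_append]
  congr 1
  by_cases h : HasAt b w i
  · rw [if_pos h]
    obtain ⟨s, h1, h2⟩ := h
    simp [cnt, h1, h2]
  · rw [if_neg h]
    cases h1 : w[i]? with
    | none => simp [cnt]
    | some s =>
      have h2 : has b s = false := Bool.eq_false_of_not_eq_true fun h2 => h ⟨s, h1, h2⟩
      simp [cnt, h2]

theorem cnt_take_mono (b : Bool) (w : List QStep) : Monotone fun i => cnt b (w.take i) := by
  classical
  refine monotone_nat_of_le_succ fun i => ?_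
  rw [cnt_take_succ]
  exact Nat.le_add_right _ _

theorem cnt_take_lt_iff {b : Bool} {w : List QStep} {i : ℕ} (h : HasAt b w i) (r : ℕ) :
    cnt b (w.take i) < cnt b (w.take r) ↔ i < r := by
  classical
  constructor
  · intro h1
    by_contra h2
    have := cnt_take_mono b w (not_lt.mp h2)
    dsimp only at this
    omega
  · intro h1
    have h2 := cnt_take_mono b w (Nat.succ_le_of_lt h1)
    dsimp only at h2
    rw [Nat.succ_eq_add_one, cnt_take_succ, if_pos h] at h2
    omega

theorem cnt_take_lt {b : Bool} {w : List QStep} {i : ℕ} (h : HasAt b w i) :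
    cnt b (w.take i) < cnt b w := by
  have := (cnt_take_lt_iff h w.length).mpr h.lt
  rwa [List.take_length] at this

theorem cnt_take_le (b : Bool) (w : List QStep) (i : ℕ) : cnt b (w.take i) ≤ cnt b w := by
  conv_rhs => rw [← List.take_append_drop i w, cnt_append]
  exact Nat.le_add_right _ _

theorem exists_cnt_take_eq {b : Bool} {w : List QStep} {a : ℕ} (h : a < cnt b w) :
    ∃ i, HasAt b w i ∧ cnt b (w.take i) = a := by
  classical
  -- The shortest prefix with more than `a` occurrences ends with the occurrence number `a`, counted
  -- from zero.
  have hex : ∃ i, a < cnt b (w.take i) := ⟨w.length, by rwa [List.take_length]⟩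
  have h1 := Nat.find_spec hex
  have h2 := @Nat.find_min _ _ hex
  cases hn : Nat.find hex with
  | zero => rw [hn] at h1; simp [cnt_nil] at h1
  | succ i =>
    rw [hn, cnt_take_succ] at h1
    have h3 := h2 (m := i) (by omega)
    by_cases h4 : HasAt b w i
    · rw [if_pos h4] at h1
      exact ⟨i, h4, by omega⟩
    · rw [if_neg h4] at h1
      omega

theorem cnt_take_injOn {b : Bool} {w : List QStep} {i j : ℕ} (hi : HasAt b w i) (hj : HasAt b w j)
    (h : cnt b (w.take i) = cnt b (w.take j)) : i = j := by
  have h1 := cnt_take_lt_iff hi j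
  have h2 := cnt_take_lt_iff hj i
  omega

/-- A strictly increasing enumeration of the positions of a block determines the number of
occurrences of the block before each of them. -/
theorem cnt_take_strictMono {b : Bool} {w : List QStep} {k : ℕ} {f : Fin k → ℕ}
    (hf : StrictMono f) (h : ∀ i, HasAt b w i ↔ ∃ a, f a = i) :
    cnt b w = k ∧ ∀ a, cnt b (w.take (f a)) = a := by
  classical
  -- Both sides count the occurrences before position `m`; increasing `m` by one adds at most one
  -- element, by injectivity of `f`.
  have key : ∀ m, cnt b (w.take m) = (Finset.univ.filter fun a => f a < m).card := by
    intro m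
    induction m with
    | zero => simp [cnt_nil]
    | succ m ih =>
      rw [cnt_take_succ, ih]
      split_ifs with hm
      · obtain ⟨a, rfl⟩ := (h m).mp hm
        have : (Finset.univ.filter fun a' => f a' < f a + 1) =
            insert a (Finset.univ.filter fun a' => f a' < f a) := by
          ext a'
          simp only [Finset.mem_filter, Finset.mem_univ, true_and, Finset.mem_insert,
            Nat.lt_succ_iff_lt_or_eq, hf.injective.eq_iff]
          tauto
        rw [this, Finset.card_insert_of_notMem (by simp)]
      · rw [add_zero]
        congr 1
        ext a'
        have : f a' ≠ m := fun h' => hm ((h m).mpr ⟨a', h'⟩)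
        simp only [Finset.mem_filter, Finset.mem_univ, true_and]
        omega
  constructor
  · have := key w.length
    rw [List.take_length] at this
    rw [this, Finset.filter_true_of_mem fun a _ => ((h _).mpr ⟨a, rfl⟩).lt]
    simp
  · intro a
    rw [key]
    simp only [hf.lt_iff_lt]
    have : (Finset.univ.filter fun a' => a' < a) = Finset.Iio a := by ext; simp
    rw [this, Fin.card_Iio]

/-- Words are determined by the positions of both blocks. -/
theorem ext_hasAt {u v : List QStep} (hl : u.length = v.length)
    (h : ∀ b i, HasAt b u i ↔ HasAt b v i) : u = v := by
  refine List.ext_getElem hl fun i h1 h2 => ext_has fun b => ?_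
  have := h b i
  simp only [HasAt, List.getElem?_eq_getElem h1, List.getElem?_eq_getElem h2,
    Option.some.injEq, exists_eq_left'] at this
  exact Bool.eq_iff_iff.mpr this

open Classical in
/-- The words encoding the `(k, l)`-quasi-shuffles. -/
def words : ℕ → ℕ → Finset (List QStep)
  | 0, 0 => {[]}
  | k + 1, 0 => (words k 0).image (left :: ·)
  | 0, l + 1 => (words 0 l).image (right :: ·)
  | k + 1, l + 1 => (words k (l + 1)).image (left :: ·) ∪
      ((words (k + 1) l).image (right :: ·) ∪ (words k l).image (both :: ·))

/-- The recursive definition of `words` serves to split sums by the first letter; this description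
serves to cut and concatenate words. -/
theorem mem_words {k l : ℕ} {w : List QStep} :
    w ∈ words k l ↔ cnt true w = k ∧ cnt false w = l := by
  induction w generalizing k l with
  | nil =>
    cases k <;> cases l <;> simp [words, cnt_nil]
  | cons s w ih =>
    cases k <;> cases l <;> cases s <;> simp [words, cnt_cons, has, ih]

theorem sum_words_succ_succ {A : Type*} [AddCommMonoid A] (k l : ℕ) (f : List QStep → A) :
    ∑ w ∈ words (k + 1) (l + 1), f w = ∑ w ∈ words k (l + 1), f (left :: w) +
      (∑ w ∈ words (k + 1) l, f (right :: w) + ∑ w ∈ words k l, f (both :: w)) := by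
  classical
  rw [words, Finset.sum_union, Finset.sum_union, Finset.sum_image (by simp),
    Finset.sum_image (by simp), Finset.sum_image (by simp)]
  · rw [Finset.disjoint_left]
    intro w h1 h2
    simp only [Finset.mem_image] at h1 h2
    grind
  · rw [Finset.disjoint_left]
    intro w h1 h2
    simp only [Finset.mem_image, Finset.mem_union] at h1 h2
    grind

theorem sum_words_zero_zero {A : Type*} [AddCommMonoid A] (f : List QStep → A) :
    ∑ w ∈ words 0 0, f w = f [] := by
  rw [words, Finset.sum_singleton]

theorem sum_words_succ_zero {A : Type*} [AddCommMonoid A] (k : ℕ) (f : List QStep → A) :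
    ∑ w ∈ words (k + 1) 0, f w = ∑ w ∈ words k 0, f (left :: w) := by
  classical
  rw [words, Finset.sum_image (by simp)]

theorem sum_words_zero_succ {A : Type*} [AddCommMonoid A] (l : ℕ) (f : List QStep → A) :
    ∑ w ∈ words 0 (l + 1), f w = ∑ w ∈ words 0 l, f (right :: w) := by
  classical
  rw [words, Finset.sum_image (by simp)]

/-- The positions of the blocks of the word `w` are the images of the blocks of the
quasi-shuffle `σ`. -/
structure Codes {k l : ℕ} (σ : QuasiShuffle k l) (w : List QStep) : Prop where
  length_eq : w.length = (σ.1 : ℕ)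
  left_iff : ∀ i, HasAt true w i ↔ ∃ a : Fin k, (σ.2.1 (Fin.castAdd l a) : ℕ) = i
  right_iff : ∀ i, HasAt false w i ↔ ∃ a : Fin l, (σ.2.1 (Fin.natAdd k a) : ℕ) = i

variable {k l : ℕ}

theorem _root_.QuasiShuffle.strictMono_left (σ : QuasiShuffle k l) :
    StrictMono fun a : Fin k => (σ.2.1 (Fin.castAdd l a) : ℕ) := fun _ _ h => σ.2.2.2.1 h

theorem _root_.QuasiShuffle.strictMono_right (σ : QuasiShuffle k l) :
    StrictMono fun a : Fin l => (σ.2.1 (Fin.natAdd k a) : ℕ) := fun _ _ h => σ.2.2.2.2 h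

theorem Codes.cnt_left {σ : QuasiShuffle k l} {w : List QStep} (h : Codes σ w) :
    cnt true w = k ∧ ∀ a : Fin k, cnt true (w.take (σ.2.1 (Fin.castAdd l a))) = a :=
  cnt_take_strictMono σ.strictMono_left h.left_iff

theorem Codes.cnt_right {σ : QuasiShuffle k l} {w : List QStep} (h : Codes σ w) :
    cnt false w = l ∧ ∀ a : Fin l, cnt false (w.take (σ.2.1 (Fin.natAdd k a))) = a :=
  cnt_take_strictMono σ.strictMono_right h.right_iff

theorem Codes.mem_words {σ : QuasiShuffle k l} {w : List QStep} (h : Codes σ w) :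
    w ∈ words k l := QStep.mem_words.mpr ⟨h.cnt_left.1, h.cnt_right.1⟩

/-- The letter at `i` records which blocks meet the fibre of `i`. Surjectivity rules out that
neither does, so three letters suffice. -/
theorem exists_codes (σ : QuasiShuffle k l) : ∃ w, Codes σ w := by
  classical
  let L : Fin σ.1 → Prop := fun i => ∃ a : Fin k, σ.2.1 (Fin.castAdd l a) = i
  let R : Fin σ.1 → Prop := fun i => ∃ a : Fin l, σ.2.1 (Fin.natAdd k a) = i
  have hLR : ∀ i, L i ∨ R i := by
    intro i
    obtain ⟨a, rfl⟩ := σ.2.2.1 i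
    induction a using Fin.addCases with
    | left a => exact Or.inl ⟨a, rfl⟩
    | right a => exact Or.inr ⟨a, rfl⟩
  refine ⟨List.ofFn fun i => if ¬ R i then left else if ¬ L i then right else both, by simp,
    fun i => ?_, fun i => ?_⟩
  all_goals
    by_cases hi : i < (σ.1 : ℕ)
    · have := hLR ⟨i, hi⟩
      simp only [HasAt, List.getElem?_ofFn, hi, dif_pos, Option.some.injEq, exists_eq_left']
      simp only [L, R, Fin.ext_iff] at this ⊢
      split_ifs <;> simp_all [has]
    · constructor
      · rintro h
        exact absurd (by simpa using h.lt) hi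
      · rintro ⟨a, rfl⟩
        exact absurd (Fin.is_lt _) hi

theorem exists_strictMono_hasAt {b : Bool} {w : List QStep} (h : cnt b w = k) :
    ∃ f : Fin k → Fin w.length, StrictMono f ∧ ∀ i, HasAt b w i ↔ ∃ a, (f a : ℕ) = i := by
  classical
  subst h
  let f : Fin (cnt b w) → ℕ := fun a => (exists_cnt_take_eq (b := b) (w := w) a.2).choose
  have hf : ∀ a, HasAt b w (f a) ∧ cnt b (w.take (f a)) = a := fun a =>
    (exists_cnt_take_eq (b := b) (w := w) a.2).choose_spec
  refine ⟨fun a => ⟨f a, (hf a).1.lt⟩, fun a a' haa => ?_, fun i => ⟨fun hi => ?_, ?_⟩⟩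
  · rw [Fin.lt_def]
    change f a < f a'
    rw [← cnt_take_lt_iff (hf a).1, (hf a).2, (hf a').2]
    exact haa
  · refine ⟨⟨cnt b (w.take i), cnt_take_lt hi⟩, ?_⟩
    exact cnt_take_injOn (hf _).1 hi (hf _).2
  · rintro ⟨a, rfl⟩
    exact (hf a).1

/-- The increasing enumerations of the positions of the two blocks are the two halves of `σ`; it is
surjective because every letter contains a block. -/
theorem exists_codes_of_mem_words {w : List QStep} (h : w ∈ words k l) :
    ∃ σ : QuasiShuffle k l, Codes σ w := by
  obtain ⟨h1, h2⟩ := mem_words.mp h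
  obtain ⟨f, hf, hf'⟩ := exists_strictMono_hasAt h1
  obtain ⟨g, hg, hg'⟩ := exists_strictMono_hasAt h2
  have hsurj : Function.Surjective (Fin.append f g) := by
    intro i
    rcases has_or w[i] with hi | hi
    · obtain ⟨a, ha⟩ := (hf' i).mp ⟨w[i], by simp, hi⟩
      exact ⟨Fin.castAdd l a, by simpa using Fin.ext ha⟩
    · obtain ⟨a, ha⟩ := (hg' i).mp ⟨w[i], by simp, hi⟩
      exact ⟨Fin.natAdd k a, by simpa using Fin.ext ha⟩
  have hlen : w.length ≤ k + l := by simpa using Fintype.card_le_of_surjective _ hsurj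
  refine ⟨⟨⟨w.length, by omega⟩, Fin.append f g, hsurj, ?_, ?_⟩, rfl, ?_, ?_⟩
  · simpa using hf
  · simpa using hg
  · simpa using hf'
  · simpa using hg'

theorem Codes.word_unique {σ : QuasiShuffle k l} {u v : List QStep} (hu : Codes σ u)
    (hv : Codes σ v) : u = v := by
  refine ext_hasAt (hu.length_eq.trans hv.length_eq.symm) fun b i => ?_
  cases b
  · rw [hu.right_iff, hv.right_iff]
  · rw [hu.left_iff, hv.left_iff]

/-- The word fixes the range of each half of `σ`, and a strictly increasing map on `Fin k` is
determined by its range. -/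
theorem Codes.unique {σ ρ : QuasiShuffle k l} {w : List QStep} (hσ : Codes σ w)
    (hρ : Codes ρ w) : σ = ρ := by
  have hn : σ.1 = ρ.1 := Fin.ext (hσ.length_eq.symm.trans hρ.length_eq)
  have hL : ∀ a, (σ.2.1 (Fin.castAdd l a) : ℕ) = ρ.2.1 (Fin.castAdd l a) :=
    congrFun ((StrictMono.range_inj σ.strictMono_left ρ.strictMono_left).mp
      (Set.ext fun i => (hσ.left_iff i).symm.trans (hρ.left_iff i)))
  have hR : ∀ a, (σ.2.1 (Fin.natAdd k a) : ℕ) = ρ.2.1 (Fin.natAdd k a) :=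
    congrFun ((StrictMono.range_inj σ.strictMono_right ρ.strictMono_right).mp
      (Set.ext fun i => (hσ.right_iff i).symm.trans (hρ.right_iff i)))
  obtain ⟨n, s, hs⟩ := σ
  obtain ⟨n', s', hs'⟩ := ρ
  dsimp only at hn
  subst hn
  have : s = s' := by
    ext a
    induction a using Fin.addCases with
    | left a => exact hL a
    | right a => exact hR a
  subst this
  rfl

/-- Sums over quasi-shuffles are sums over words. -/
theorem sum_quasiShuffle {A : Type*} [AddCommMonoid A] (f : QuasiShuffle k l → A)
    (g : List QStep → A) (h : ∀ σ w, Codes σ w → f σ = g w) :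
    ∑ σ, f σ = ∑ w ∈ words k l, g w := by
  choose w hw using fun σ : QuasiShuffle k l => exists_codes σ
  refine Finset.sum_bij (fun σ _ => w σ) (fun σ _ => (hw σ).mem_words) ?_ ?_
    fun σ _ => h σ _ (hw σ)
  · intro σ _ ρ _ hσρ
    have := hw ρ
    rw [← hσρ] at this
    exact (hw σ).unique this
  · intro u hu
    obtain ⟨σ, hσ⟩ := exists_codes_of_mem_words hu
    exact ⟨σ, Finset.mem_univ _, (hw σ).word_unique hσ⟩

end QStep

/-! ### The quasi-shuffle identity for Hilbert polynomials -/

theorem hilbertPoly_succ_succ (n : ℕ) (x : ℚ) :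
    hilbertPoly (n + 1) (x + 1) = hilbertPoly (n + 1) x + hilbertPoly n x := by
  have h1 : ∏ i ∈ Finset.range (n + 1), (x + 1 - (i : ℚ)) =
      (∏ i ∈ Finset.range n, (x - (i : ℚ))) * (x + 1) := by
    rw [Finset.prod_range_succ']
    simp
  have h2 : (n.factorial : ℚ) ≠ 0 := by positivity
  have h3 : (n : ℚ) + 1 ≠ 0 := by positivity
  rw [hilbertPoly, hilbertPoly, hilbertPoly, h1, Finset.prod_range_succ, Nat.factorial_succ]
  push_cast
  field_simp
  ring

theorem hilbertPoly_succ_zero (n : ℕ) : hilbertPoly (n + 1) 0 = 0 := by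
  rw [hilbertPoly, Finset.prod_range_succ']
  simp

theorem exists_polynomial_hilbertPoly (n : ℕ) :
    ∃ p : Polynomial ℚ, ∀ x, p.eval x = hilbertPoly n x := by
  refine ⟨(∏ i ∈ Finset.range n, (Polynomial.X - Polynomial.C (i : ℚ))) *
    Polynomial.C (n.factorial : ℚ)⁻¹, fun x => ?_⟩
  simp [Polynomial.eval_prod, hilbertPoly, div_eq_mul_inv]

open QStep in
-- A pair of subsets of `[x]` amounts to its union together with a word telling which elements
-- belong to the first, the second or both. The induction on `x` uses Pascal's rule and the
-- recursion on the first letter.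
theorem sum_words_hilbertPoly_natCast (x k l : ℕ) :
    ∑ w ∈ words k l, hilbertPoly w.length x = hilbertPoly k x * hilbertPoly l x := by
  induction x generalizing k l with
  | zero =>
    cases k <;> cases l <;>
      simp [sum_words_succ_succ, sum_words_succ_zero, sum_words_zero_succ, sum_words_zero_zero,
        hilbertPoly_succ_zero, hilbertPoly_zero]
  | succ x ih =>
    -- Pascal's rule turns each `H_{n+1}(x + 1)` into `H_{n+1}(x) + H_n(x)`. The terms `H_{n+1}(x)`
    -- together form `h2`, expanded by first letters; the terms `H_n(x)` are summed by `ih` for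
    -- smaller pairs.
    have h2 := ih k l
    cases k <;> cases l <;>
      simp only [sum_words_succ_succ, sum_words_succ_zero, sum_words_zero_succ,
        sum_words_zero_zero, List.length_cons, List.length_nil, hilbertPoly_zero] at h2 <;>
      simp only [sum_words_succ_succ, sum_words_succ_zero, sum_words_zero_succ,
        sum_words_zero_zero, List.length_cons, List.length_nil, Nat.cast_succ, Finset.sum_add_distrib,
        ih, hilbertPoly_succ_succ, hilbertPoly_zero] <;> linear_combination h2

open QStep in
/-- The multiplicativity of `H_n(X)` with respect to quasi-shuffles. -/
theorem sum_words_hilbertPoly (x : ℚ) (k l : ℕ) :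
    ∑ w ∈ words k l, hilbertPoly w.length x = hilbertPoly k x * hilbertPoly l x := by
  choose p hp using exists_polynomial_hilbertPoly
  have h : ∑ w ∈ words k l, p w.length = p k * p l := by
    -- Both sides are polynomials, and they agree at all natural numbers.
    refine Polynomial.eq_of_infinite_eval_eq _ _ ?_
    refine (Set.infinite_range_of_injective (Nat.cast_injective (R := ℚ))).mono ?_
    rintro _ ⟨n, rfl⟩
    simp only [Set.mem_ofPred_eq, Polynomial.eval_finsetSum, Polynomial.eval_mul, hp]
    exact sum_words_hilbertPoly_natCast n k l
  have := congrArg (Polynomial.eval x) h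
  simpa only [Polynomial.eval_finsetSum, Polynomial.eval_mul, hp] using this

/-! ### The product of compositions and the removal of a first part -/

namespace QSym
open QStep

/-- The composition obtained by merging two compositions along a word. -/
def qmerge : List QStep → List ℕ+ → List ℕ+ → List ℕ+
  | left :: w, m :: a, b => m :: qmerge w a b
  | right :: w, a, n :: b => n :: qmerge w a b
  | both :: w, m :: a, n :: b => (m + n) :: qmerge w a b
  | _, _, _ => []

/-- The `i`-th part of a composition, `0` out of range. -/
def part (a : List ℕ+) (i : ℕ) : ℕ := (a[i]?).elim 0 (fun n => (n : ℕ))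

/-- The contribution of one of the two factors to the `i`-th part. -/
def blockPart (s : Bool) (w : List QStep) (a : List ℕ+) (i : ℕ) : ℕ :=
  open Classical in if HasAt s w i then part a (cnt s (w.take i)) else 0

theorem hasAt_cons_zero {s : Bool} {t : QStep} {w : List QStep} :
    HasAt s (t :: w) 0 ↔ has s t = true := by simp [HasAt]

theorem hasAt_cons_succ {s : Bool} {t : QStep} {w : List QStep} {i : ℕ} :
    HasAt s (t :: w) (i + 1) ↔ HasAt s w i := by simp [HasAt]

theorem blockPart_cons_zero (s : Bool) (t : QStep) (w : List QStep) (a : List ℕ+) :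
    blockPart s (t :: w) a 0 = if has s t = true then part a 0 else 0 := by
  simp [blockPart, hasAt_cons_zero, cnt_nil]

theorem blockPart_cons_succ (s : Bool) (t : QStep) (w : List QStep) (a : List ℕ+) (i : ℕ) :
    blockPart s (t :: w) a (i + 1) =
      blockPart s w (a.drop (if has s t = true then 1 else 0)) i := by
  unfold blockPart
  by_cases h : HasAt s w i
  · rw [if_pos (hasAt_cons_succ.mpr h), if_pos h]
    simp [cnt_cons, part, add_comm]
  · rw [if_neg fun h' => h (hasAt_cons_succ.mp h'), if_neg h]

/-- This links the recursion on the first letter with a description part by part. Parts are compared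
in `ℕ`, where a block absent from a letter contributes zero. -/
theorem qmerge_spec (w : List QStep) (a b : List ℕ+) (ha : cnt true w = a.length)
    (hb : cnt false w = b.length) :
    (qmerge w a b).map (fun n : ℕ+ => (n : ℕ)) =
      List.ofFn fun i : Fin w.length => blockPart true w a i + blockPart false w b i := by
  induction w generalizing a b with
  | nil =>
    obtain rfl : a = [] := List.length_eq_zero_iff.mp ha.symm
    obtain rfl : b = [] := List.length_eq_zero_iff.mp hb.symm
    simp [qmerge]
  | cons s w ih =>
    cases s <;> cases a <;> cases b <;>
      simp [cnt_cons, has] at ha hb <;>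
      simp [qmerge, ih, ha, hb, List.ofFn_succ, blockPart_cons_zero, blockPart_cons_succ, has,
        part]

theorem map_collapse {m n : ℕ} (a : Fin m → ℕ+) (σ : Fin m → Fin n)
    (hσ : Function.Surjective σ) : (collapse a σ hσ).map (fun n : ℕ+ => (n : ℕ)) =
      List.ofFn fun p => ∑ i, if σ i = p then (a i : ℕ) else 0 := by
  exact List.map_ofFn

/-- Each fibre of `σ` meets each block at most once, and the index of that element is the number of
earlier occurrences of the block. -/
theorem collapse_eq_qmerge (a b : List ℕ+) (σ : QuasiShuffle a.length b.length) (w : List QStep)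
    (h : Codes σ w) :
    collapse (Fin.append a.get b.get) σ.2.1 σ.2.2.1 = qmerge w a b := by
  have h1 := h.cnt_left
  have h2 := h.cnt_right
  have hsum : ∀ {m : ℕ} (c : List ℕ+) (s : Bool) (f : Fin c.length → Fin m)
      (_ : ∀ i, HasAt s w i ↔ ∃ a, (f a : ℕ) = i) (_ : ∀ a, cnt s (w.take (f a)) = a) (p : Fin m),
      ∑ i, (if f i = p then ((c.get i : ℕ+) : ℕ) else 0) = blockPart s w c p := by
    intro m c s f hf hf' p
    unfold blockPart
    split_ifs with hp
    · obtain ⟨a, ha⟩ := (hf p).mp hp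
      have ha : f a = p := Fin.ext ha
      subst ha
      rw [Finset.sum_eq_single a]
      · simp [hf', part]
      · intro a' _ hne
        rw [if_neg]
        intro heq
        have := hf' a'
        rw [heq, hf'] at this
        exact hne (Fin.ext this.symm)
      · simp
    · refine Finset.sum_eq_zero fun i _ => if_neg fun hi => hp ((hf p).mpr ⟨i, by rw [hi]⟩)
  apply (List.map_injective_iff.mpr PNat.coe_injective)
  refine Eq.trans ?_ (qmerge_spec w a b h1.1 h2.1).symm
  refine (map_collapse _ _ _).trans (List.ext_getElem (by simp [h.length_eq]) fun i hi hi' => ?_)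
  simp only [List.getElem_ofFn]
  rw [Fin.sum_univ_add]
  simp only [Fin.append_left, Fin.append_right]
  rw [hsum a true _ h.left_iff h1.2, hsum b false _ h.right_iff h2.2]

theorem mul_basis (a b : List ℕ+) :
    mul (basis a) (basis b) = ∑ w ∈ words a.length b.length, basis (qmerge w a b) := by
  rw [mul, Finsupp.linearCombination_single, one_smul, Finsupp.linearCombination_single, one_smul]
  refine sum_quasiShuffle _ _ fun σ w h => ?_
  rw [collapse_eq_qmerge a b σ w h]

theorem nil_mul_basis (b : List ℕ+) : mul (basis []) (basis b) = basis b := by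
  rw [mul_basis]
  -- The arbitrary `f` absorbs the part prepended at each step of the induction.
  suffices h : ∀ f : List ℕ+ → QSym, ∑ w ∈ words 0 b.length, f (qmerge w [] b) = f b from h _
  induction b with
  | nil => exact fun f => sum_words_zero_zero _
  | cons n b ih =>
    intro f
    rw [List.length_cons, sum_words_zero_succ]
    exact ih fun b => f (n :: b)

theorem mul_nil_basis (b : List ℕ+) : mul (basis b) (basis []) = basis b := by
  rw [mul_basis]
  suffices h : ∀ f : List ℕ+ → QSym, ∑ w ∈ words b.length 0, f (qmerge w b []) = f b from h _
  induction b with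
  | nil => exact fun f => sum_words_zero_zero _
  | cons n b ih =>
    intro f
    rw [List.length_cons, sum_words_succ_zero]
    exact ih fun b => f (n :: b)

/-- The linear map `a ↦ (n, a₁, …, a_k)`. -/
def consMap (n : ℕ+) : QSym →ₗ[ℚ] QSym := Finsupp.lmapDomain ℚ ℚ (n :: ·)

theorem consMap_basis (n : ℕ+) (a : List ℕ+) : consMap n (basis a) = basis (n :: a) := by
  simp [consMap]

theorem cons_mul_cons (m n : ℕ+) (a b : List ℕ+) :
    mul (basis (m :: a)) (basis (n :: b)) = consMap m (mul (basis a) (basis (n :: b))) +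
      (consMap n (mul (basis (m :: a)) (basis b)) + consMap (m + n) (mul (basis a) (basis b))) := by
  simp only [mul_basis, map_sum, consMap_basis, List.length_cons]
  rw [sum_words_succ_succ]
  rfl

/-- Removing a first part equal to `n`; the identity if `n = 0`. -/
def behead (n : ℕ) : QSym →ₗ[ℚ] QSym :=
  if n = 0 then LinearMap.id else Finsupp.linearCombination ℚ fun a =>
    match a with
    | [] => 0
    | m :: a => if (m : ℕ) = n then basis a else 0

theorem behead_zero : behead 0 = LinearMap.id := if_pos rfl

theorem behead_nil {n : ℕ} (hn : n ≠ 0) : behead n (basis []) = 0 := by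
  simp [behead, hn]

theorem behead_cons {n : ℕ} (hn : n ≠ 0) (m : ℕ+) (a : List ℕ+) :
    behead n (basis (m :: a)) = if (m : ℕ) = n then basis a else 0 := by
  simp [behead, hn]

theorem behead_consMap {n : ℕ} (hn : n ≠ 0) (m : ℕ+) (A : QSym) :
    behead n (consMap m A) = if (m : ℕ) = n then A else 0 := by
  suffices h : behead n ∘ₗ consMap m = if (m : ℕ) = n then LinearMap.id else 0 by
    have := LinearMap.congr_fun h A
    split_ifs at this ⊢ <;> exact this
  refine Finsupp.lhom_ext' fun a => LinearMap.ext_ring ?_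
  change behead n (consMap m (basis a)) = _
  rw [consMap_basis, behead_cons hn]
  split_ifs <;> rfl

/-- This turns coefficients at a composition into coefficients at a shorter one, and so drives the
induction in `kappa_mul`. -/
theorem apply_cons (n : ℕ+) (c : List ℕ+) (A : QSym) : A (n :: c) = behead n A c := by
  suffices h : Finsupp.lapply (R := ℚ) (n :: c) = Finsupp.lapply c ∘ₗ behead n from
    LinearMap.congr_fun h A
  refine Finsupp.lhom_ext' fun a => LinearMap.ext_ring ?_
  change (basis a) (n :: c) = behead n (basis a) c
  cases a with
  | nil => simp [behead_nil]
  | cons m a =>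
    rw [behead_cons n.ne_zero]
    by_cases h : m = n
    · subst h
      simp [Finsupp.single_apply]
    · rw [if_neg (by simpa using h)]
      simp [h]

/-- The first part of a quasi-shuffle comes from the left, from the right, or is a sum `m + m'`;
these cases are the pairs `(n, 0)`, `(0, n)` and `(m, m')`. The convention that `behead 0` is the
identity makes a single formula of them. -/
theorem behead_mul_basis (n : ℕ) (a b : List ℕ+) : behead n (mul (basis a) (basis b)) =
    ∑ p ∈ Finset.HasAntidiagonal.antidiagonal n, mul (behead p.1 (basis a)) (behead p.2 (basis b)) := by
  rcases Nat.eq_zero_or_pos n with rfl | hn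
  · simp [behead_zero]
  have hn' := hn.ne'
  cases a with
  | nil =>
    rw [nil_mul_basis, Finset.sum_eq_single (0, n)]
    · simp only [behead_zero, LinearMap.id_apply]
      cases b with
      | nil => simp [behead_nil hn']
      | cons m b => rw [behead_cons hn']; split_ifs <;> simp [nil_mul_basis]
    · rintro ⟨i, j⟩ h1 h2
      rw [Finset.HasAntidiagonal.mem_antidiagonal] at h1
      have : i ≠ 0 := by rintro rfl; simp_all
      simp [behead_nil this]
    · simp
  | cons m a =>
    cases b with
    | nil =>
      rw [mul_nil_basis, Finset.sum_eq_single (n, 0)]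
      · simp only [behead_zero, LinearMap.id_apply]
        rw [behead_cons hn']; split_ifs <;> simp [mul_nil_basis]
      · rintro ⟨i, j⟩ h1 h2
        rw [Finset.HasAntidiagonal.mem_antidiagonal] at h1
        have : j ≠ 0 := by rintro rfl; simp_all
        simp [behead_nil this]
      · simp
    | cons m' b =>
      rw [cons_mul_cons, map_add, map_add, behead_consMap hn', behead_consMap hn',
        behead_consMap hn']
      obtain ⟨n, rfl⟩ : ∃ k, n = k + 1 := ⟨n - 1, by omega⟩
      -- Among the pairs with nonzero coordinates only `(m, m')` removes a part from both factors.
      have hmid : ∑ p ∈ Finset.HasAntidiagonal.antidiagonal (n + 1), (if p.1 ≠ 0 ∧ p.2 ≠ 0 then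
          mul (behead p.1 (basis (m :: a))) (behead p.2 (basis (m' :: b))) else 0) =
          if ((m + m' : ℕ+) : ℕ) = n + 1 then mul (basis a) (basis b) else 0 := by
        have : ∀ p ∈ Finset.HasAntidiagonal.antidiagonal (n + 1), (if p.1 ≠ 0 ∧ p.2 ≠ 0 then
          mul (behead p.1 (basis (m :: a))) (behead p.2 (basis (m' :: b))) else 0) =
            if p = ((m : ℕ), (m' : ℕ)) then mul (basis a) (basis b) else 0 := by
          rintro ⟨i, j⟩ -
          have hm := m.ne_zero
          have hm' := m'.ne_zero
          by_cases hi : i = 0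
          · simp [hi, hm.symm]
          by_cases hj : j = 0
          · simp [hj, hm'.symm]
          simp only [ne_eq, hi, hj, not_false_eq_true, and_self, if_true, behead_cons hi,
            behead_cons hj, Prod.mk.injEq, eq_comm (a := i), eq_comm (a := j)]
          by_cases h1 : (m : ℕ) = i <;> by_cases h2 : (m' : ℕ) = j <;> simp [h1, h2]
        rw [Finset.sum_congr rfl this, Finset.sum_ite_eq']
        simp only [Finset.HasAntidiagonal.mem_antidiagonal]
        rfl
      have hsplit : ∀ F : ℕ × ℕ → QSym, ∑ p ∈ Finset.HasAntidiagonal.antidiagonal (n + 1), F p =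
          F (n + 1, 0) + (F (0, n + 1) + ∑ p ∈ Finset.HasAntidiagonal.antidiagonal (n + 1),
            if p.1 ≠ 0 ∧ p.2 ≠ 0 then F p else 0) := by
        intro F
        rw [← Finset.sum_filter, ← Finset.sum_filter_not_add_sum_filter _ (fun p => p.1 ≠ 0 ∧ p.2 ≠ 0),
          ← add_assoc]
        congr 1
        have : (Finset.HasAntidiagonal.antidiagonal (n + 1)).filter (fun p => ¬ (p.1 ≠ 0 ∧ p.2 ≠ 0)) =
            {(n + 1, 0), (0, n + 1)} := by
          ext ⟨i, j⟩
          simp only [Finset.mem_filter, Finset.HasAntidiagonal.mem_antidiagonal, Finset.mem_insert,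
            Finset.mem_singleton, Prod.mk.injEq]
          omega
        rw [this, Finset.sum_pair (by simp)]
      rw [hsplit, hmid]
      simp only [behead_zero, LinearMap.id_apply, behead_cons hn']
      congr 1
      · split_ifs <;> simp
      · congr 1
        split_ifs <;> simp

theorem behead_mul (n : ℕ) (A B : QSym) : behead n (mul A B) =
    ∑ p ∈ Finset.HasAntidiagonal.antidiagonal n, mul (behead p.1 A) (behead p.2 B) := by
  suffices h : mul.compr₂ (behead n) =
      ∑ p ∈ Finset.HasAntidiagonal.antidiagonal n, mul.compl₁₂ (behead p.1) (behead p.2) by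
    have := LinearMap.congr_fun (LinearMap.congr_fun h A) B
    simpa using this
  refine Finsupp.lhom_ext' fun a => LinearMap.ext_ring (Finsupp.lhom_ext' fun b =>
    LinearMap.ext_ring ?_)
  simpa using behead_mul_basis n a b

theorem mul_apply_nil (A B : QSym) : mul A B [] = A [] * B [] := by
  suffices h : mul.compr₂ (Finsupp.lapply []) =
      (LinearMap.mul ℚ ℚ).compl₁₂ (Finsupp.lapply []) (Finsupp.lapply []) from
    LinearMap.congr_fun (LinearMap.congr_fun h A) B
  refine Finsupp.lhom_ext' fun a => LinearMap.ext_ring (Finsupp.lhom_ext' fun b =>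
    LinearMap.ext_ring ?_)
  change mul (basis a) (basis b) [] = basis a [] * basis b []
  cases a with
  | nil => rw [nil_mul_basis]; simp
  | cons m a =>
    cases b with
    | nil => rw [mul_nil_basis]; simp
    | cons n b =>
      have h : ∀ (m : ℕ+) (A : QSym), consMap m A [] = 0 := fun m A =>
        Finsupp.mapDomain_of_notMem_range _ _ (by simp)
      rw [cons_mul_cons]
      simp [h]

end QSym

/-! ### Quasi-shuffles of packed matrices and multiplicativity of `Δ` -/

namespace PackedMatrix
open QStep

theorem weight_merge (M : PackedMatrix) {k l : ℕ} (σ : Fin M.row → Fin k) (τ : Fin M.col → Fin l)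
    (hσ : Function.Surjective σ) (hτ : Function.Surjective τ) :
    (M.merge σ τ hσ hτ).weight = M.weight := by
  change ∑ i, ∑ j, (mapMatrix σ * M.entry * (mapMatrix τ)ᵀ) i j = ∑ a, ∑ b, M.entry a b
  simp only [mapMatrix_mul_mul_apply]
  calc ∑ i, ∑ j, ∑ b, ∑ a, (if i = σ a ∧ j = τ b then M.entry a b else 0)
      = ∑ i, ∑ b, ∑ a, ∑ j, (if i = σ a ∧ j = τ b then M.entry a b else 0) := by
        refine Finset.sum_congr rfl fun i _ => ?_
        rw [Finset.sum_comm]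
        refine Finset.sum_congr rfl fun b _ => Finset.sum_comm
    _ = ∑ i, ∑ b, ∑ a, (if i = σ a then M.entry a b else 0) := by
        simp [ite_and]
    _ = ∑ a, ∑ b, ∑ i, (if i = σ a then M.entry a b else 0) := by
        rw [Finset.sum_comm]
        simp_rw [Finset.sum_comm (γ := Fin k)]
        exact Finset.sum_comm
    _ = _ := by simp

open Classical in
/-- The contribution of one of the two factors to an entry of a quasi-shuffle of matrices. -/
def blockEntry (s : Bool) (u v : List QStep) (M : PackedMatrix) (i j : ℕ) : ℕ :=
  if HasAt s u i ∧ HasAt s v j then M.get (cnt s (u.take i)) (cnt s (v.take j)) else 0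

theorem blockEntry_of_hasAt {s : Bool} {u v : List QStep} {M : PackedMatrix} {i j : ℕ}
    (hi : HasAt s u i) (hj : HasAt s v j) :
    blockEntry s u v M i j = M.get (cnt s (u.take i)) (cnt s (v.take j)) := if_pos ⟨hi, hj⟩

theorem blockEntry_of_not {s : Bool} {u v : List QStep} {M : PackedMatrix} {i j : ℕ}
    (h : ¬ (HasAt s u i ∧ HasAt s v j)) : blockEntry s u v M i j = 0 := if_neg h

/-- The entries of the quasi-shuffle of two matrices along a word for the rows and a word for the
columns. -/
def mergeEntry (M N : PackedMatrix) (u v : List QStep) (i j : ℕ) : ℕ :=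
  blockEntry true u v M i j + blockEntry false u v N i j

open Classical in
/-- The quasi-shuffle of two packed matrices along a word for the rows and a word for the
columns. -/
def wordMerge (M N : PackedMatrix) (u v : List QStep) : PackedMatrix :=
  if h : ∃ Q : PackedMatrix, Q.row = u.length ∧ Q.col = v.length ∧
    ∀ i j, Q.get i j = mergeEntry M N u v i j then h.choose else empty

theorem wordMerge_eq {M N Q : PackedMatrix} {u v : List QStep} (hr : Q.row = u.length)
    (hc : Q.col = v.length) (h : ∀ i j, Q.get i j = mergeEntry M N u v i j) :
    wordMerge M N u v = Q := by
  have hex : ∃ Q : PackedMatrix, Q.row = u.length ∧ Q.col = v.length ∧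
    ∀ i j, Q.get i j = mergeEntry M N u v i j := ⟨Q, hr, hc, h⟩
  rw [wordMerge, dif_pos hex]
  obtain ⟨h1, h2, h3⟩ := hex.choose_spec
  exact ext_get (h1.trans hr.symm) (h2.trans hc.symm) fun i j => (h3 i j).trans (h i j).symm

/-- By `hf'` and `hg'` the maps `f` and `g` are injective, so at most one entry of `M` lands on `(i,
j)`. -/
theorem sum_blockEntry (M : PackedMatrix) (s : Bool) {u v : List QStep} {m n : ℕ}
    (f : Fin M.row → Fin m) (g : Fin M.col → Fin n)
    (hf : ∀ i, HasAt s u i ↔ ∃ a, (f a : ℕ) = i) (hf' : ∀ a, cnt s (u.take (f a)) = a)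
    (hg : ∀ i, HasAt s v i ↔ ∃ a, (g a : ℕ) = i) (hg' : ∀ a, cnt s (v.take (g a)) = a)
    (i : Fin m) (j : Fin n) :
    ∑ b, ∑ a, (if i = f a ∧ j = g b then M.entry a b else 0) = blockEntry s u v M i j := by
  unfold blockEntry
  split_ifs with h
  · obtain ⟨h1, h2⟩ := h
    obtain ⟨a, ha⟩ := (hf i).mp h1
    obtain ⟨b, hb⟩ := (hg j).mp h2
    obtain rfl : f a = i := Fin.ext ha
    obtain rfl : g b = j := Fin.ext hb
    have hfi : ∀ a', f a = f a' → a' = a := fun a' h => Fin.ext (by rw [← hf', ← hf' a, h])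
    have hgi : ∀ b', g b = g b' → b' = b := fun b' h => Fin.ext (by rw [← hg', ← hg' b, h])
    rw [hf', hg', get_val, Finset.sum_eq_single b, Finset.sum_eq_single a]
    · simp
    · intro a' _ hne
      exact if_neg fun h => hne (hfi _ h.1)
    · simp
    · intro b' _ hne
      exact Finset.sum_eq_zero fun a' _ => if_neg fun h => hne (hgi _ h.2)
    · simp
  · refine Finset.sum_eq_zero fun b _ => Finset.sum_eq_zero fun a _ => if_neg ?_
    rintro ⟨h1, h2⟩
    exact h ⟨(hf i).mpr ⟨a, by rw [h1]⟩, (hg j).mpr ⟨b, by rw [h2]⟩⟩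

theorem diagSum_entry_castAdd_castAdd (M N : PackedMatrix) (a : Fin M.row) (b : Fin M.col) :
    (M.diagSum N).entry (Fin.castAdd N.row a) (Fin.castAdd N.col b) = M.entry a b := by
  simp [diagSum]

theorem diagSum_entry_natAdd_natAdd (M N : PackedMatrix) (a : Fin N.row) (b : Fin N.col) :
    (M.diagSum N).entry (Fin.natAdd M.row a) (Fin.natAdd M.col b) = N.entry a b := by
  simp [diagSum]

theorem diagSum_entry_castAdd_natAdd (M N : PackedMatrix) (a : Fin M.row) (b : Fin N.col) :
    (M.diagSum N).entry (Fin.castAdd N.row a) (Fin.natAdd M.col b) = 0 := by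
  simp [diagSum]

theorem diagSum_entry_natAdd_castAdd (M N : PackedMatrix) (a : Fin N.row) (b : Fin M.col) :
    (M.diagSum N).entry (Fin.natAdd M.row a) (Fin.castAdd N.col b) = 0 := by
  simp [diagSum]

/-- The matrix with the entries prescribed by two coding words is packed because it is a `merge`
along surjections. Hence the choice defining `wordMerge` succeeds and its default value `empty`
plays no role. -/
theorem merge_eq_wordMerge {M N : PackedMatrix} {σ : QuasiShuffle M.row N.row}
    {τ : QuasiShuffle M.col N.col} {u v : List QStep} (hu : Codes σ u) (hv : Codes τ v) :
    (M.diagSum N).merge σ.2.1 τ.2.1 σ.2.2.1 τ.2.2.1 = wordMerge M N u v ∧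
    (wordMerge M N u v).row = u.length ∧ (wordMerge M N u v).col = v.length ∧
    ∀ i j, (wordMerge M N u v).get i j = mergeEntry M N u v i j := by
  have key : ∀ (i : Fin σ.1) (j : Fin τ.1),
      ((M.diagSum N).merge σ.2.1 τ.2.1 σ.2.2.1 τ.2.2.1).entry i j = mergeEntry M N u v i j := by
    intro i j
    refine (mapMatrix_mul_mul_apply _ _ _ i j).trans ?_
    refine (Fin.sum_univ_add (a := M.col) (b := N.col) _).trans ?_
    refine congrArg₂ (· + ·) ?_ ?_
    · rw [← sum_blockEntry M true (fun a => σ.2.1 (Fin.castAdd _ a))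
        (fun a => τ.2.1 (Fin.castAdd _ a)) hu.left_iff hu.cnt_left.2 hv.left_iff hv.cnt_left.2]
      refine Finset.sum_congr rfl fun b _ => ?_
      refine (Fin.sum_univ_add (a := M.row) (b := N.row) _).trans ?_
      simp only [diagSum_entry_castAdd_castAdd, diagSum_entry_natAdd_castAdd, ite_self,
        Finset.sum_const_zero, add_zero]
    · rw [← sum_blockEntry N false (fun a => σ.2.1 (Fin.natAdd _ a))
        (fun a => τ.2.1 (Fin.natAdd _ a)) hu.right_iff hu.cnt_right.2 hv.right_iff hv.cnt_right.2]
      refine Finset.sum_congr rfl fun b _ => ?_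
      refine (Fin.sum_univ_add (a := M.row) (b := N.row) _).trans ?_
      simp only [diagSum_entry_natAdd_natAdd, diagSum_entry_castAdd_natAdd, ite_self,
        Finset.sum_const_zero, zero_add]
  have hget : ∀ i j, ((M.diagSum N).merge σ.2.1 τ.2.1 σ.2.2.1 τ.2.2.1).get i j =
      mergeEntry M N u v i j := by
    intro i j
    by_cases h : i < (σ.1 : ℕ) ∧ j < (τ.1 : ℕ)
    · exact (dif_pos h).trans (key ⟨i, h.1⟩ ⟨j, h.2⟩)
    · refine (dif_neg h).trans ?_
      have h0 : ∀ s, ¬ (HasAt s u i ∧ HasAt s v j) := fun s h' =>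
        h ⟨hu.length_eq ▸ h'.1.lt, hv.length_eq ▸ h'.2.lt⟩
      simp only [mergeEntry, blockEntry, h0, if_false]
  have := wordMerge_eq (M := M) (N := N) hu.length_eq.symm hv.length_eq.symm hget
  rw [this]
  exact ⟨rfl, hu.length_eq.symm, hv.length_eq.symm, hget⟩

theorem wordMerge_spec {M N : PackedMatrix} {u v : List QStep} (hu : u ∈ words M.row N.row) (hv : v ∈ words M.col N.col) :
    (wordMerge M N u v).row = u.length ∧ (wordMerge M N u v).col = v.length ∧
      (∀ i j, (wordMerge M N u v).get i j = mergeEntry M N u v i j) ∧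
      (wordMerge M N u v).weight = M.weight + N.weight := by
  obtain ⟨σ, hσ⟩ := exists_codes_of_mem_words hu
  obtain ⟨τ, hτ⟩ := exists_codes_of_mem_words hv
  obtain ⟨h1, h2, h3, h4⟩ := merge_eq_wordMerge hσ hτ
  refine ⟨h2, h3, h4, ?_⟩
  rw [← h1]
  exact (weight_merge _ _ _ _ _).trans (weight_diagSum M N)

/-- The cut points of the two words divide the matrix into four quadrants. In the two off-diagonal
ones, the entries read off fall in the zero blocks of `A.diagSum B`. -/
theorem blockEntry_append (s : Bool) {u₁ u₂ v₁ v₂ : List QStep} {A B : PackedMatrix}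
    (hr : A.row = cnt s u₁) (hc : A.col = cnt s v₁) (i j : ℕ) :
    blockEntry s (u₁ ++ u₂) (v₁ ++ v₂) (A.diagSum B) i j = blockEntry s u₁ v₁ A i j +
      if u₁.length ≤ i ∧ v₁.length ≤ j then
        blockEntry s u₂ v₂ B (i - u₁.length) (j - v₁.length) else 0 := by
  have hlen : ∀ (w : List QStep) (i : ℕ), w.length ≤ i → ¬ HasAt s w i :=
    fun w i h h' => absurd h'.lt (not_lt.mpr h)
  rcases lt_or_ge i u₁.length with hi | hi <;> rcases lt_or_ge j v₁.length with hj | hj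
  · rw [if_neg (by omega), add_zero]
    by_cases h : HasAt s u₁ i ∧ HasAt s v₁ j
    · rw [blockEntry_of_hasAt h.1 h.2, blockEntry_of_hasAt ((hasAt_append_left _ hi).mpr h.1)
        ((hasAt_append_left _ hj).mpr h.2), get_diagSum, List.take_append_of_le_length hi.le,
        List.take_append_of_le_length hj.le, if_neg, add_zero]
      have := cnt_take_lt h.1
      omega
    · rw [blockEntry_of_not h, blockEntry_of_not]
      rwa [hasAt_append_left _ hi, hasAt_append_left _ hj]
  · rw [if_neg (by omega), add_zero, blockEntry_of_not fun h => hlen _ _ hj h.2]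
    by_cases h : HasAt s (u₁ ++ u₂) i ∧ HasAt s (v₁ ++ v₂) j
    · have := cnt_take_lt ((hasAt_append_left _ hi).mp h.1)
      rw [blockEntry_of_hasAt h.1 h.2, get_diagSum, List.take_append_of_le_length hi.le,
        if_neg (by omega), List.take_append, List.take_of_length_le hj, cnt_append,
        get_of_col_le _ (by omega)]
    · rw [blockEntry_of_not h]
  · rw [if_neg (by omega), add_zero, blockEntry_of_not fun h => hlen _ _ hi h.1]
    by_cases h : HasAt s (u₁ ++ u₂) i ∧ HasAt s (v₁ ++ v₂) j
    · have := cnt_take_lt ((hasAt_append_left _ hj).mp h.2)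
      rw [blockEntry_of_hasAt h.1 h.2, get_diagSum, List.take_append_of_le_length hj.le,
        if_neg (by omega), List.take_append, List.take_of_length_le hi, cnt_append,
        get_of_row_le _ (by omega)]
    · rw [blockEntry_of_not h]
  · rw [if_pos ⟨hi, hj⟩, blockEntry_of_not fun h => hlen _ _ hi h.1, zero_add]
    by_cases h : HasAt s u₂ (i - u₁.length) ∧ HasAt s v₂ (j - v₁.length)
    · rw [blockEntry_of_hasAt h.1 h.2, blockEntry_of_hasAt ((hasAt_append_right _ hi).mpr h.1)
        ((hasAt_append_right _ hj).mpr h.2), get_diagSum, List.take_append, List.take_append,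
        List.take_of_length_le hi, List.take_of_length_le hj, cnt_append, cnt_append,
        get_of_row_le _ (by omega), if_pos (by omega), zero_add, hr, hc, Nat.add_sub_cancel_left,
        Nat.add_sub_cancel_left]
    · rw [blockEntry_of_not h, blockEntry_of_not]
      rwa [hasAt_append_right _ hi, hasAt_append_right _ hj]

theorem wordMerge_append {A B C D : PackedMatrix} {u₁ u₂ v₁ v₂ : List QStep}
    (hu₁ : u₁ ∈ words A.row C.row) (hv₁ : v₁ ∈ words A.col C.col)
    (hu₂ : u₂ ∈ words B.row D.row) (hv₂ : v₂ ∈ words B.col D.col) :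
    wordMerge (A.diagSum B) (C.diagSum D) (u₁ ++ u₂) (v₁ ++ v₂) =
      (wordMerge A C u₁ v₁).diagSum (wordMerge B D u₂ v₂) := by
  obtain ⟨r1, c1, g1, -⟩ := wordMerge_spec hu₁ hv₁
  obtain ⟨r2, c2, g2, -⟩ := wordMerge_spec hu₂ hv₂
  rw [mem_words] at hu₁ hv₁
  refine wordMerge_eq (by simp [diagSum_row, r1, r2]) (by simp [diagSum_col, c1, c2]) fun i j => ?_
  rw [mergeEntry, blockEntry_append true hu₁.1.symm hv₁.1.symm,
    blockEntry_append false hu₁.2.symm hv₁.2.symm, get_diagSum, r1, c1, g1, g2]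
  unfold mergeEntry
  split_ifs <;> omega

theorem append_mem_words {k l k' l' : ℕ} {u v : List QStep} (hu : u ∈ words k l)
    (hv : v ∈ words k' l') : u ++ v ∈ words (k + k') (l + l') := by
  rw [mem_words] at *
  simp [cnt_append, hu, hv]

/-- Splittings of a quasi-shuffle come from splittings of the factors. -/
theorem exists_split_of_wordMerge {M N P Q : PackedMatrix} {u v : List QStep}
    (hu : u ∈ words M.row N.row) (hv : v ∈ words M.col N.col)
    (h : P.diagSum Q = wordMerge M N u v) :
    ∃ A B C D : PackedMatrix, A.diagSum B = M ∧ C.diagSum D = N ∧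
      u.take P.row ∈ words A.row C.row ∧ v.take P.col ∈ words A.col C.col ∧
      u.drop P.row ∈ words B.row D.row ∧ v.drop P.col ∈ words B.col D.col ∧
      wordMerge A C (u.take P.row) (v.take P.col) = P ∧
      wordMerge B D (u.drop P.row) (v.drop P.col) = Q := by
  obtain ⟨hr, hc, hg, -⟩ := wordMerge_spec hu hv
  have hu' := mem_words.mp hu
  have hv' := mem_words.mp hv
  have hle : ∀ s i j, blockEntry s u v (if s = true then M else N) i j ≤
      mergeEntry M N u v i j := by
    intro s i j
    cases s
    · exact Nat.le_add_left _ _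
    · exact Nat.le_add_right _ _
  -- Entries are natural numbers and cannot cancel: a nonzero entry of a factor stays nonzero in the
  -- quasi-shuffle, so it lies in one of the blocks `P`, `Q`. Each factor is thus block diagonal for
  -- the induced cut.
  have key : ∀ s (X : PackedMatrix), X = (if s = true then M else N) → cnt s u = X.row →
      cnt s v = X.col → ∀ a b, X.get a b ≠ 0 →
        (a < cnt s (u.take P.row) ↔ b < cnt s (v.take P.col)) := by
    intro s X hX hXr hXc a b hab
    have hlt := get_ne_zero hab
    obtain ⟨i, hi, rfl⟩ := exists_cnt_take_eq (hXr.symm ▸ hlt.1)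
    obtain ⟨j, hj, rfl⟩ := exists_cnt_take_eq (hXc.symm ▸ hlt.2)
    rw [cnt_take_lt_iff hi, cnt_take_lt_iff hj]
    apply get_diagSum_ne_zero (B := Q)
    rw [h, hg]
    have h1 := hle s i j
    rw [← hX, blockEntry, if_pos ⟨hi, hj⟩] at h1
    omega
  obtain ⟨A, B, hAB, hAr, hAc⟩ := exists_diagSum_eq M
    ((cnt_take_le true u P.row).trans_eq hu'.1) ((cnt_take_le true v P.col).trans_eq hv'.1)
    (key true M rfl hu'.1 hv'.1)
  obtain ⟨C, D, hCD, hCr, hCc⟩ := exists_diagSum_eq N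
    ((cnt_take_le false u P.row).trans_eq hu'.2) ((cnt_take_le false v P.col).trans_eq hv'.2)
    (key false N rfl hu'.2 hv'.2)
  have hsplit : ∀ s (w : List QStep) i, cnt s w = cnt s (w.take i) + cnt s (w.drop i) :=
    fun s w i => by rw [← cnt_append, List.take_append_drop]
  have hM1 : A.row + B.row = M.row := congrArg row hAB
  have hM2 : A.col + B.col = M.col := congrArg col hAB
  have hN1 : C.row + D.row = N.row := congrArg row hCD
  have hN2 : C.col + D.col = N.col := congrArg col hCD
  have w1 : u.take P.row ∈ words A.row C.row := mem_words.mpr ⟨hAr.symm, hCr.symm⟩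
  have w2 : v.take P.col ∈ words A.col C.col := mem_words.mpr ⟨hAc.symm, hCc.symm⟩
  have w3 : u.drop P.row ∈ words B.row D.row := by
    have h1 := hsplit true u P.row
    have h2 := hsplit false u P.row
    exact mem_words.mpr ⟨by omega, by omega⟩
  have w4 : v.drop P.col ∈ words B.col D.col := by
    have h1 := hsplit true v P.col
    have h2 := hsplit false v P.col
    exact mem_words.mpr ⟨by omega, by omega⟩
  have happ := wordMerge_append w1 w2 w3 w4
  rw [List.take_append_drop, List.take_append_drop, hAB, hCD, ← h] at happ
  have hPr : P.row + Q.row = u.length := (congrArg row h).trans hr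
  have hPc : P.col + Q.col = v.length := (congrArg col h).trans hc
  obtain ⟨r1, c1, -, -⟩ := wordMerge_spec w1 w2
  obtain ⟨e1, e2⟩ := diagSum_inj happ.symm (by rw [r1, List.length_take]; omega)
    (by rw [c1, List.length_take]; omega)
  exact ⟨A, B, C, D, hAB, hCD, w1, w2, w3, w4, e1, e2⟩

/-- The multiplicativity of the coproduct `Δ` with respect to the quasi-shuffle product. -/
theorem sum_splittings_wordMerge {V : Type*} [AddCommMonoid V] (M N : PackedMatrix)
    (f : PackedMatrix → PackedMatrix → V) :
    ∑ u ∈ words M.row N.row, ∑ v ∈ words M.col N.col,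
      ∑ p ∈ (wordMerge M N u v).splittings, f p.1 p.2 =
    ∑ p ∈ M.splittings, ∑ q ∈ N.splittings,
      ∑ u₁ ∈ words p.1.row q.1.row, ∑ v₁ ∈ words p.1.col q.1.col,
      ∑ u₂ ∈ words p.2.row q.2.row, ∑ v₂ ∈ words p.2.col q.2.col,
        f (wordMerge p.1 q.1 u₁ v₁) (wordMerge p.2 q.2 u₂ v₂) := by
  simp only [Finset.sum_sigma']
  symm
  refine Finset.sum_bij (fun z _ => ⟨z.2.2.1 ++ z.2.2.2.2.1, z.2.2.2.1 ++ z.2.2.2.2.2,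
    (wordMerge z.1.1 z.2.1.1 z.2.2.1 z.2.2.2.1,
      wordMerge z.1.2 z.2.1.2 z.2.2.2.2.1 z.2.2.2.2.2)⟩) ?_ ?_ ?_ ?_
  · rintro ⟨⟨A, B⟩, ⟨C, D⟩, u₁, v₁, u₂, v₂⟩ hz
    simp only [Finset.mem_sigma, mem_splittings] at hz ⊢
    obtain ⟨rfl, rfl, w1, w2, w3, w4⟩ := hz
    exact ⟨append_mem_words w1 w3, append_mem_words w2 w4, (wordMerge_append w1 w2 w3 w4).symm⟩
  · rintro ⟨⟨A, B⟩, ⟨C, D⟩, u₁, v₁, u₂, v₂⟩ hz ⟨⟨A', B'⟩, ⟨C', D'⟩, u₁', v₁', u₂', v₂'⟩ hz' heq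
    simp only [Finset.mem_sigma, mem_splittings] at hz hz'
    obtain ⟨hM, hN, w1, w2, w3, w4⟩ := hz
    obtain ⟨hM', hN', w1', w2', w3', w4'⟩ := hz'
    simp only [Sigma.mk.injEq, heq_eq_eq, Prod.mk.injEq] at heq
    obtain ⟨e1, e2, e3, e4⟩ := heq
    -- The size of the first block tells where the concatenated words were cut.
    have hl1 : u₁.length = u₁'.length := by
      rw [← (wordMerge_spec w1 w2).1, ← (wordMerge_spec w1' w2').1, e3]
    have hl2 : v₁.length = v₁'.length := by
      rw [← (wordMerge_spec w1 w2).2.1, ← (wordMerge_spec w1' w2').2.1, e3]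
    obtain ⟨rfl, rfl⟩ := List.append_inj e1 hl1
    obtain ⟨rfl, rfl⟩ := List.append_inj e2 hl2
    rw [mem_words] at w1 w2 w1' w2'
    obtain ⟨rfl, rfl⟩ := diagSum_inj (hM.trans hM'.symm) (w1.1.symm.trans w1'.1)
      (w2.1.symm.trans w2'.1)
    obtain ⟨rfl, rfl⟩ := diagSum_inj (hN.trans hN'.symm) (w1.2.symm.trans w1'.2)
      (w2.2.symm.trans w2'.2)
    rfl
  · rintro ⟨u, v, P, Q⟩ hz
    simp only [Finset.mem_sigma, mem_splittings] at hz
    obtain ⟨hu, hv, h⟩ := hz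
    obtain ⟨A, B, C, D, hM, hN, w1, w2, w3, w4, hP, hQ⟩ := exists_split_of_wordMerge hu hv h
    refine ⟨⟨(A, B), (C, D), u.take P.row, v.take P.col, u.drop P.row, v.drop P.col⟩, ?_, ?_⟩
    · simp only [Finset.mem_sigma, mem_splittings]
      exact ⟨hM, hN, w1, w2, w3, w4⟩
    · simp [hP, hQ]
  · rintro ⟨⟨A, B⟩, ⟨C, D⟩, u₁, v₁, u₂, v₂⟩ hz
    rfl

end PackedMatrix

/-! ### The product of `H_Pack` and the removal of a first block -/

namespace HPack
open QStep

theorem mul_basis (M N : PackedMatrix) : mul (basis M) (basis N) =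
    ∑ u ∈ words M.row N.row, ∑ v ∈ words M.col N.col, basis (wordMerge M N u v) := by
  rw [mul, Finsupp.linearCombination_single, one_smul, Finsupp.linearCombination_single, one_smul]
  refine sum_quasiShuffle _ _ fun σ u hu => sum_quasiShuffle _ _ fun τ v hv => ?_
  rw [(merge_eq_wordMerge hu hv).1]

/-- The multiplicativity of the weight `H_{row}(x) H_{col}(y)`. -/
theorem sum_hilbertWeight (x y : ℚ) (M N : PackedMatrix) :
    ∑ u ∈ words M.row N.row, ∑ v ∈ words M.col N.col, hilbertWeight x y (wordMerge M N u v) =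
      hilbertWeight x y M * hilbertWeight x y N := by
  calc _ = ∑ u ∈ words M.row N.row, ∑ v ∈ words M.col N.col,
      hilbertPoly u.length x * hilbertPoly v.length y := by
        refine Finset.sum_congr rfl fun u hu => Finset.sum_congr rfl fun v hv => ?_
        obtain ⟨hr, hc, -⟩ := wordMerge_spec hu hv
        rw [hilbertWeight, hr, hc]
    _ = _ := by
        rw [← Finset.sum_mul_sum, sum_words_hilbertPoly, sum_words_hilbertPoly, hilbertWeight,
          hilbertWeight]
        ring

/-- The lift of `QSym.behead` to packed matrices: removing a first block of weight `n`, with the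
coefficient `H_{row}(x) H_{col}(y)` of this block. -/
def behead (x y : ℚ) (n : ℕ) : HPack →ₗ[ℚ] HPack :=
  Finsupp.linearCombination ℚ fun M => ∑ p ∈ M.splittings,
    if p.1.weight = n then hilbertWeight x y p.1 • basis p.2 else 0

theorem behead_basis (x y : ℚ) (n : ℕ) (M : PackedMatrix) :
    behead x y n (basis M) = ∑ p ∈ M.splittings,
      if p.1.weight = n then hilbertWeight x y p.1 • basis p.2 else 0 := by
  rw [behead, Finsupp.linearCombination_single, one_smul]

/-- Only the empty first block has weight zero, and its coefficient is `1`. -/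
theorem behead_zero (x y : ℚ) : behead x y 0 = LinearMap.id := by
  refine Finsupp.lhom_ext' fun M => LinearMap.ext_ring ?_
  change behead x y 0 (basis M) = basis M
  rw [behead_basis, Finset.sum_eq_single (PackedMatrix.empty, M)]
  · simp [weight_empty, hilbertWeight_empty]
  · rintro ⟨A, B⟩ h hne
    rw [mem_splittings] at h
    refine if_neg fun h0 => hne ?_
    rw [weight_eq_zero_iff] at h0
    dsimp only at h0 h
    rw [h0, empty_diagSum] at h
    rw [h0, h]
  · intro h
    exact absurd (mem_splittings.mpr (empty_diagSum M)) h

/-- By multiplicativity of `Δ`, first blocks of the product are quasi-shuffles of first blocks of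
the factors. Their weight is the sum of the two weights whatever the words, so the coefficients can
be summed by `sum_hilbertWeight`; the antidiagonal then only selects the pair of weights. -/
theorem behead_mul_basis (x y : ℚ) (n : ℕ) (M N : PackedMatrix) :
    behead x y n (mul (basis M) (basis N)) = ∑ p ∈ Finset.HasAntidiagonal.antidiagonal n,
      mul (behead x y p.1 (basis M)) (behead x y p.2 (basis N)) := by
  have hL : behead x y n (mul (basis M) (basis N)) = ∑ p ∈ M.splittings, ∑ q ∈ N.splittings,
      if p.1.weight + q.1.weight = n then
        (hilbertWeight x y p.1 * hilbertWeight x y q.1) • mul (basis p.2) (basis q.2) else 0 := by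
    simp only [mul_basis M N, map_sum, behead_basis]
    rw [sum_splittings_wordMerge M N
      fun P Q => if P.weight = n then hilbertWeight x y P • basis Q else 0]
    refine Finset.sum_congr rfl fun p _ => Finset.sum_congr rfl fun q _ => ?_
    rw [← sum_hilbertWeight, mul_basis]
    split_ifs with h
    · simp only [Finset.sum_smul]
      refine Finset.sum_congr rfl fun u hu => Finset.sum_congr rfl fun v hv => ?_
      rw [Finset.smul_sum]
      refine Finset.sum_congr rfl fun u' _ => ?_
      rw [Finset.smul_sum]
      refine Finset.sum_congr rfl fun v' _ => ?_
      rw [if_pos]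
      rw [(wordMerge_spec hu hv).2.2.2, h]
    · refine Finset.sum_eq_zero fun u hu => Finset.sum_eq_zero fun v hv =>
        Finset.sum_eq_zero fun u' _ => Finset.sum_eq_zero fun v' _ => if_neg ?_
      rwa [(wordMerge_spec hu hv).2.2.2]
  rw [hL]
  simp only [behead_basis, map_sum, LinearMap.sum_apply]
  rw [Finset.sum_comm (s := Finset.HasAntidiagonal.antidiagonal n), Finset.sum_comm]
  refine Finset.sum_congr rfl fun q _ => ?_
  rw [Finset.sum_comm (s := Finset.HasAntidiagonal.antidiagonal n)]
  refine Finset.sum_congr rfl fun p _ => ?_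
  have : ∀ r ∈ Finset.HasAntidiagonal.antidiagonal n,
      mul (if p.1.weight = r.1 then hilbertWeight x y p.1 • basis p.2 else 0)
        (if q.1.weight = r.2 then hilbertWeight x y q.1 • basis q.2 else 0) =
      if r = (p.1.weight, q.1.weight) then
        (hilbertWeight x y p.1 * hilbertWeight x y q.1) • mul (basis p.2) (basis q.2) else 0 := by
    rintro ⟨i, j⟩ -
    simp only [Prod.mk.injEq, eq_comm (a := i), eq_comm (a := j)]
    by_cases h1 : p.1.weight = i
    · by_cases h2 : q.1.weight = j
      · rw [if_pos h1, if_pos h2, if_pos ⟨h1, h2⟩, map_smul, map_smul, LinearMap.smul_apply,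
          smul_smul, mul_comm]
      · rw [if_neg h2, map_zero, if_neg fun h => h2 h.2]
    · rw [if_neg h1, map_zero, LinearMap.zero_apply, if_neg fun h => h1 h.1]
  rw [Finset.sum_congr rfl this, Finset.sum_ite_eq']
  simp only [Finset.HasAntidiagonal.mem_antidiagonal]

theorem behead_mul (x y : ℚ) (n : ℕ) (A B : HPack) : behead x y n (mul A B) =
    ∑ p ∈ Finset.HasAntidiagonal.antidiagonal n, mul (behead x y p.1 A) (behead x y p.2 B) := by
  suffices h : mul.compr₂ (behead x y n) = ∑ p ∈ Finset.HasAntidiagonal.antidiagonal n,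
      mul.compl₁₂ (behead x y p.1) (behead x y p.2) by
    have := LinearMap.congr_fun (LinearMap.congr_fun h A) B
    simpa using this
  refine Finsupp.lhom_ext' fun M => LinearMap.ext_ring (Finsupp.lhom_ext' fun N =>
    LinearMap.ext_ring ?_)
  simpa using behead_mul_basis x y n M N

theorem counit_mul (A B : HPack) : counit (mul A B) = counit A * counit B := by
  suffices h : mul.compr₂ counit = (LinearMap.mul ℚ ℚ).compl₁₂ counit counit from
    LinearMap.congr_fun (LinearMap.congr_fun h A) B
  refine Finsupp.lhom_ext' fun M => LinearMap.ext_ring (Finsupp.lhom_ext' fun N =>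
    LinearMap.ext_ring ?_)
  change counit (mul (basis M) (basis N)) = counit (basis M) * counit (basis N)
  have hc : ∀ P : PackedMatrix, counit (basis P) = if P.weight = 0 then 1 else 0 := by
    intro P
    rw [counit, Finsupp.linearCombination_single, one_smul]
    by_cases h : P = PackedMatrix.empty
    · rw [if_pos h, if_pos (P.weight_eq_zero_iff.mpr h)]
    · rw [if_neg h, if_neg fun h' => h (P.weight_eq_zero_iff.mp h')]
  rw [mul_basis, hc, hc]
  simp only [map_sum, hc]
  by_cases h : M.weight = 0 ∧ N.weight = 0
  · rw [if_pos h.1, if_pos h.2, mul_one]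
    obtain ⟨h1, h2⟩ := h
    rw [weight_eq_zero_iff] at h1 h2
    subst h1 h2
    have hr : empty.row = 0 := rfl
    have hc : empty.col = 0 := rfl
    rw [hr, hc, sum_words_zero_zero, sum_words_zero_zero, if_pos]
    rw [(wordMerge_spec (M := empty) (N := empty) (mem_words.mpr ⟨rfl, rfl⟩)
      (mem_words.mpr ⟨rfl, rfl⟩)).2.2.2]
    rfl
  · have : (if M.weight = 0 then (1 : ℚ) else 0) * (if N.weight = 0 then 1 else 0) = 0 := by
      rw [ite_zero_mul_ite_zero, if_neg h]
    rw [this]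
    refine Finset.sum_eq_zero fun u hu => Finset.sum_eq_zero fun v hv => if_neg ?_
    rw [(wordMerge_spec hu hv).2.2.2]
    omega

end HPack

/-! ### Multiplicativity of `κ` -/

/-- For `n > 0`, a decomposition of `M` whose first block has weight `n` is a splitting with first
block of weight `n` and a decomposition of the rest; the coefficient of that block is the one built
into `HPack.behead`. -/
theorem behead_kappa (x y : ℚ) (n : ℕ) (X : HPack) :
    QSym.behead n (kappa x y X) = kappa x y (HPack.behead x y n X) := by
  rcases Nat.eq_zero_or_pos n with rfl | hn
  · rw [QSym.behead_zero, HPack.behead_zero]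
    rfl
  suffices h : QSym.behead n ∘ₗ kappa x y = kappa x y ∘ₗ HPack.behead x y n from
    LinearMap.congr_fun h X
  refine Finsupp.lhom_ext' fun M => LinearMap.ext_ring ?_
  change QSym.behead n (kappa x y (HPack.basis M)) = kappa x y (HPack.behead x y n (HPack.basis M))
  have hR : kappa x y (HPack.behead x y n (HPack.basis M)) =
      ∑ p ∈ M.splittings with p.1.weight = n, ∑ L ∈ p.2.decompositions, hilbertWeight x y p.1 •
        (L.map (hilbertWeight x y)).prod • QSym.basis (L.map pweight) := by
    rw [HPack.behead_basis, ← Finset.sum_filter, map_sum]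
    refine Finset.sum_congr rfl fun p _ => ?_
    rw [map_smul, kappa_basis, Finset.smul_sum]
  rw [hR, kappa_basis, map_sum, Finset.sum_sigma']
  · symm
    refine Finset.sum_of_injOn (fun z => z.1.1 :: z.2) ?_ ?_ ?_ ?_
    · rintro ⟨⟨A, B⟩, L⟩ hz ⟨⟨A', B'⟩, L'⟩ hz' heq
      simp only [Finset.coe_sigma, Set.mem_sigma_iff, Finset.mem_coe, mem_decompositions] at hz hz'
      simp only [List.cons.injEq] at heq
      obtain ⟨rfl, rfl⟩ := heq
      obtain rfl : B = B' := hz.2.2.symm.trans hz'.2.2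
      rfl
    · rintro ⟨⟨A, B⟩, L⟩ hz
      simp only [Finset.coe_sigma, Set.mem_sigma_iff, Finset.mem_coe, mem_decompositions,
        Finset.mem_filter, mem_splittings] at hz ⊢
      obtain ⟨⟨h1, h2⟩, h3, h4⟩ := hz
      refine ⟨?_, by rw [diagProd_cons, h4, h1]⟩
      intro N hN
      rcases List.mem_cons.mp hN with rfl | hN
      · intro h0
        rw [h0, weight_empty] at h2
        omega
      · exact h3 N hN
    · intro L hL hL'
      rw [map_smul]
      cases L with
      | nil => rw [List.map_nil, List.map_nil, QSym.behead_nil hn.ne', smul_zero]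
      | cons N L =>
        rw [mem_decompositions] at hL
        obtain ⟨h1, h2⟩ := hL
        rw [List.map_cons, List.map_cons, QSym.behead_cons hn.ne',
          pweight_coe (h1 N (by simp)), if_neg, smul_zero]
        intro hw
        refine hL' ⟨⟨(N, diagProd L), L⟩, ?_, rfl⟩
        simp only [Finset.coe_sigma, Set.mem_sigma_iff, Finset.mem_coe, mem_decompositions,
          Finset.mem_filter, mem_splittings]
        exact ⟨⟨h2, hw⟩, fun P hP => h1 P (by simp [hP]), trivial⟩
    · rintro ⟨⟨A, B⟩, L⟩ hz
      simp only [Finset.mem_sigma, mem_decompositions, Finset.mem_filter, mem_splittings] at hz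
      obtain ⟨⟨h1, h2⟩, h3, h4⟩ := hz
      have hA : A ≠ empty := by
        rintro rfl
        rw [weight_empty] at h2
        omega
      simp only [List.map_cons, List.prod_cons, map_smul]
      rw [QSym.behead_cons hn.ne', pweight_coe hA, if_pos h2, smul_smul]

theorem apply_nil_kappa (x y : ℚ) (X : HPack) : kappa x y X [] = HPack.counit X := by
  rw [← kappa_counit x y X]
  suffices h : Finsupp.lapply (R := ℚ) [] = QSym.counit from LinearMap.congr_fun h _
  refine Finsupp.lhom_ext' fun a => LinearMap.ext_ring ?_
  change (QSym.basis a) [] = QSym.counit (QSym.basis a)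
  simp [QSym.counit, Finsupp.single_apply]

/-- The multiplicativity of `κ_{x,y}`. -/
theorem kappa_mul (x y : ℚ) (X Y : HPack) :
    kappa x y (HPack.mul X Y) = QSym.mul (kappa x y X) (kappa x y Y) := by
  -- The elements `X` and `Y` stay arbitrary, since removing a block from a basis element yields a
  -- linear combination.
  suffices h : ∀ (c : List ℕ+) (X Y : HPack),
      kappa x y (HPack.mul X Y) c = QSym.mul (kappa x y X) (kappa x y Y) c from
    Finsupp.ext fun c => h c X Y
  intro c
  induction c with
  | nil =>
    intro X Y
    rw [QSym.mul_apply_nil, apply_nil_kappa, apply_nil_kappa, apply_nil_kappa, HPack.counit_mul]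
  | cons n c ih =>
    intro X Y
    rw [QSym.apply_cons, QSym.apply_cons, behead_kappa, HPack.behead_mul, QSym.behead_mul, map_sum,
      Finsupp.finsetSum_apply, Finsupp.finsetSum_apply]
    refine Finset.sum_congr rfl fun p _ => ?_
    rw [ih, behead_kappa, behead_kappa]

theorem isBialgebraMorphism_kappa (x y : ℚ) :
    IsBialgebraMorphism HPack.structureMaps QSym.structureMaps (kappa x y) where
  map_mul := kappa_mul x y
  map_one := kappa_empty x y
  map_comul := kappa_comul x y
  map_counit := kappa_counit x y

/-! ### Diagonal matrices and the values of `κ_{1,1}` -/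

theorem hilbertPoly_one_left (x : ℚ) : hilbertPoly 1 x = x := by simp [hilbertPoly]

theorem hilbertPoly_two_left (x : ℚ) : hilbertPoly 2 x = x * (x - 1) / 2 := by
  simp [hilbertPoly, Finset.prod_range_succ]

theorem hilbertPoly_succ_one (n : ℕ) : hilbertPoly (n + 1) 1 = if n = 0 then 1 else 0 := by
  have h := hilbertPoly_succ_succ n 0
  rw [zero_add, hilbertPoly_succ_zero, zero_add] at h
  rw [h]
  cases n
  · simp [hilbertPoly_zero]
  · simp [hilbertPoly_succ_zero]

namespace PackedMatrix

theorem row_pos {M : PackedMatrix} (h : M ≠ empty) : 0 < M.row := by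
  by_contra h0
  refine h (M.weight_eq_zero_iff.mp (Finset.sum_eq_zero fun i _ => ?_))
  exact absurd i.2 (by omega)

theorem col_pos {M : PackedMatrix} (h : M ≠ empty) : 0 < M.col := by
  obtain ⟨j, -⟩ := M.row_ne_zero ⟨0, row_pos h⟩
  exact j.pos

theorem hilbertWeight_one_one {M : PackedMatrix} (h : M ≠ empty) :
    hilbertWeight 1 1 M = if M.row = 1 ∧ M.col = 1 then 1 else 0 := by
  have hr := row_pos h
  have hc := col_pos h
  rw [hilbertWeight, show M.row = (M.row - 1) + 1 by omega, show M.col = (M.col - 1) + 1 by omega,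
    hilbertPoly_succ_one, hilbertPoly_succ_one, ite_zero_mul_ite_zero, one_mul]
  simp only [Nat.add_eq_right]

/-- The diagonal matrix with given positive diagonal entries. -/
abbrev ofDiag {n : ℕ} (a : Fin n → ℕ+) : PackedMatrix where
  row := n
  col := n
  entry := Matrix.diagonal fun i => (a i : ℕ)
  row_ne_zero i := ⟨i, by simp⟩
  col_ne_zero i := ⟨i, by simp⟩

theorem isDiagonal_ofDiag {n : ℕ} (a : Fin n → ℕ+) : (ofDiag a).IsDiagonal :=
  ⟨rfl, fun _ _ h => Matrix.diagonal_apply_ne _ fun h' => h (congrArg Fin.val h')⟩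

theorem diag_ofDiag {n : ℕ} (a : Fin n → ℕ+) (h : (ofDiag a).IsDiagonal) :
    (ofDiag a).diag h = List.ofFn a := by
  rw [diag]
  congr 1
  ext i
  simp
  rfl

theorem IsDiagonal.exists_eq_ofDiag {M : PackedMatrix} (h : M.IsDiagonal) :
    ∃ (n : ℕ) (a : Fin n → ℕ+), M = ofDiag a := by
  obtain ⟨r, c, e, h1, h2⟩ := M
  have hrc : r = c := h.1
  subst hrc
  refine ⟨r, fun i => ⟨e i i, h.entry_pos i⟩, ?_⟩
  congr 1
  ext i j
  by_cases hij : i = j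
  · subst hij
    simp
  · rw [Matrix.diagonal_apply_ne _ hij]
    exact h.2 i j fun h' => hij (Fin.ext h')

theorem get_ofDiag {n : ℕ} (a : Fin n → ℕ+) (i j : ℕ) :
    (ofDiag a).get i j = if h : i < n then if i = j then (a ⟨i, h⟩ : ℕ) else 0 else 0 := by
  unfold get
  by_cases hi : i < n
  · by_cases hij : i = j
    · subst hij
      simp [hi]
    · by_cases hj : j < n
      · simp [hi, hj, hij]
      · simp [hj, hij]
  · simp [hi]

/-- The diagonal sum of `1 × 1` matrices. -/
theorem diagProd_map_ofDiag (a : List ℕ+) :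
    diagProd (a.map fun n => ofDiag ![n]) = ofDiag a.get := by
  induction a with
  | nil => exact ext_get rfl rfl fun i j => by simp [diagProd_nil, get_empty, get_ofDiag]
  | cons n a ih =>
    rw [List.map_cons, diagProd_cons, ih]
    refine ext_get (Nat.add_comm _ _) (Nat.add_comm _ _) fun i j => ?_
    rw [get_diagSum, get_ofDiag, get_ofDiag, get_ofDiag]
    rcases i with _ | i <;> rcases j with _ | j <;> simp

theorem eq_ofDiag_of_row_col {M : PackedMatrix} (hr : M.row = 1) (hc : M.col = 1) :
    M = ofDiag ![M.pweight] := by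
  have hne : M ≠ empty := by
    rintro rfl
    exact absurd hr (by simp [empty])
  have hw : (M.pweight : ℕ) = ∑ i, ∑ j, M.entry i j := pweight_coe hne
  obtain ⟨r, c, e, h1, h2⟩ := M
  dsimp only at hr hc
  subst hr hc
  congr 1
  ext i j
  have hi := Subsingleton.elim i 0
  have hj := Subsingleton.elim j 0
  subst hi hj
  simpa using hw.symm

theorem ofDiag_get_injective {a b : List ℕ+} (h : ofDiag a.get = ofDiag b.get) : a = b := by
  have hl : a.length = b.length := congrArg row h
  refine List.ext_getElem hl fun i h1 h2 => PNat.coe_injective ?_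
  have := congrArg (fun M : PackedMatrix => M.get i i) h
  simpa [get_ofDiag, h1, h2] using this

theorem ofDiag_get_ofFn {n : ℕ} (a : Fin n → ℕ+) : ofDiag (List.ofFn a).get = ofDiag a := by
  refine ext_get List.length_ofFn List.length_ofFn fun i j => ?_
  simp [get_ofDiag]

/-- A decomposition with nonzero coefficient at `x = y = 1` consists of `1 × 1` matrices. -/
theorem eq_map_of_prod_hilbertWeight_ne_zero {L : List PackedMatrix} (hL : ∀ N ∈ L, N ≠ empty)
    (h : (L.map (hilbertWeight 1 1)).prod ≠ 0) :
    L = (L.map pweight).map fun n => ofDiag ![n] := by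
  rw [List.map_map]
  conv_lhs => rw [← List.map_id L]
  refine List.map_congr_left fun N hN => ?_
  have h1 : hilbertWeight 1 1 N ≠ 0 := fun h0 =>
    h (List.prod_eq_zero (h0 ▸ List.mem_map_of_mem hN))
  rw [hilbertWeight_one_one (hL N hN)] at h1
  have h2 : N.row = 1 ∧ N.col = 1 := by
    by_contra h2
    exact h1 (if_neg h2)
  exact eq_ofDiag_of_row_col h2.1 h2.2

end PackedMatrix

/-- Only decompositions into `1 × 1` blocks have a nonzero coefficient, and the diagonal entries
determine these blocks. -/
theorem kappa_one_one_ofDiag {n : ℕ} (a : Fin n → ℕ+) :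
    kappa 1 1 (HPack.basis (ofDiag a)) = QSym.basis (List.ofFn a) := by
  have hne : ∀ m : ℕ+, ofDiag ![m] ≠ empty := fun m h => absurd (congrArg row h) one_ne_zero
  rw [kappa_basis, Finset.sum_eq_single ((List.ofFn a).map fun m => ofDiag ![m])]
  · rw [List.map_map, List.map_map]
    have h1 : ∀ m : ℕ+, hilbertWeight 1 1 (ofDiag ![m]) = 1 := fun m => by
      rw [hilbertWeight_one_one (hne m), if_pos ⟨rfl, rfl⟩]
    have h2 : ∀ m : ℕ+, pweight (ofDiag ![m]) = m := fun m => by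
      apply PNat.coe_injective
      rw [pweight_coe (hne m)]
      simp [weight]
    simp [Function.comp_def, h1, h2]
  · intro L hL hne'
    rw [mem_decompositions] at hL
    by_contra h
    have h1 := eq_map_of_prod_hilbertWeight_ne_zero hL.1 (left_ne_zero_of_smul h)
    have h2 := hL.2
    rw [h1, diagProd_map_ofDiag, ← ofDiag_get_ofFn a] at h2
    rw [ofDiag_get_injective h2] at h1
    exact hne' h1
  · intro h
    refine absurd (mem_decompositions.mpr ⟨?_, ?_⟩) h
    · intro N hN
      obtain ⟨m, -, rfl⟩ := List.mem_map.mp hN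
      exact hne m
    · rw [diagProd_map_ofDiag, ofDiag_get_ofFn]

theorem kappa_one_one_of_isDiagonal (M : PackedMatrix) (h : M.IsDiagonal) :
    kappa 1 1 (HPack.basis M) = QSym.basis (M.diag h) := by
  obtain ⟨n, a, rfl⟩ := h.exists_eq_ofDiag
  rw [kappa_one_one_ofDiag, diag_ofDiag]

theorem kappa_one_one_of_not_isDiagonal (M : PackedMatrix) (h : ¬ M.IsDiagonal) :
    kappa 1 1 (HPack.basis M) = 0 := by
  rw [kappa_basis]
  refine Finset.sum_eq_zero fun L hL => ?_
  rw [mem_decompositions] at hL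
  by_contra h0
  have h1 := eq_map_of_prod_hilbertWeight_ne_zero hL.1 (left_ne_zero_of_smul h0)
  have h2 := hL.2
  rw [h1, diagProd_map_ofDiag] at h2
  exact h (h2 ▸ isDiagonal_ofDiag _)

/-! ### The counit of `δ` and the necessity of `x = y = 1` -/

/-- The counit kills compositions with two or more parts, and a nonempty matrix has no empty
decomposition; only the one-block decomposition remains. -/
theorem counit₂_kappa_basis (x y : ℚ) {M : PackedMatrix} (h : M ≠ empty) :
    QSym.counit₂ (kappa x y (HPack.basis M)) = hilbertWeight x y M := by
  rw [kappa_basis, map_sum, Finset.sum_eq_single [M]]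
  · simp [QSym.counit₂]
  · intro L hL hne
    rw [mem_decompositions] at hL
    rcases L with _ | ⟨N, _ | ⟨P, L⟩⟩
    · exact absurd hL.2.symm h
    · rw [diagProd_cons, diagProd_nil, diagSum_empty] at hL
      exact absurd (by rw [hL.2]) hne
    · rw [map_smul, QSym.counit₂, Finsupp.linearCombination_single]
      simp
  · intro h0
    refine absurd (mem_decompositions.mpr ⟨by simpa using h, ?_⟩) h0
    rw [diagProd_cons, diagProd_nil, diagSum_empty]

theorem kappa_one_one_counit₂ (X : HPack) :
    QSym.counit₂ (kappa 1 1 X) = HPack.counit₂ X := by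
  suffices h : QSym.counit₂ ∘ₗ kappa 1 1 = HPack.counit₂ from LinearMap.congr_fun h X
  refine Finsupp.lhom_ext' fun M => LinearMap.ext_ring ?_
  change QSym.counit₂ (kappa 1 1 (HPack.basis M)) = HPack.counit₂ (HPack.basis M)
  rw [HPack.counit₂, Finsupp.linearCombination_single, one_smul]
  by_cases hM : M = empty
  · rw [if_pos (Or.inl hM), hM, kappa_empty]
    simp [QSym.counit₂]
  · rw [counit₂_kappa_basis 1 1 hM, hilbertWeight_one_one hM]
    by_cases h : M.row = 1 ∧ M.col = 1
    · rw [if_pos h, if_pos (Or.inr h)]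
    · rw [if_neg h, if_neg fun h' => h'.elim hM h]

/-- The counit of `δ` suffices: sizes `1 × 1`, `1 × 2` and `2 × 1` give `xy = 1`, `x y (y - 1) / 2 =
0` and `x (x - 1) y / 2 = 0`. -/
theorem eq_one_of_isDoubleBialgebraMorphism {x y : ℚ}
    (h : IsDoubleBialgebraMorphism HPack.structureMaps QSym.structureMaps (kappa x y)) :
    x = 1 ∧ y = 1 := by
  have key : ∀ r c : ℕ, 0 < r → 0 < c → hilbertPoly r x * hilbertPoly c y =
      if r = 1 ∧ c = 1 then 1 else 0 := by
    intro r c hr hc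
    -- Only the size matters, and the matrix of ones is packed for every positive size.
    let M := ofGet r c (fun _ _ => 1) (fun _ _ => ⟨0, hc, one_ne_zero⟩)
      (fun _ _ => ⟨0, hr, one_ne_zero⟩)
    have hM : M ≠ empty := fun h' => hr.ne' (congrArg row h')
    have h1 : QSym.counit₂ (kappa x y (HPack.basis M)) = HPack.counit₂ (HPack.basis M) :=
      h.map_counit₂ (HPack.basis M)
    rw [counit₂_kappa_basis x y hM, HPack.counit₂, Finsupp.linearCombination_single, one_smul] at h1
    refine Eq.trans h1 ?_
    by_cases hrc : r = 1 ∧ c = 1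
    · rw [if_pos hrc]
      exact if_pos (Or.inr hrc)
    · rw [if_neg hrc]
      exact if_neg fun h' => h'.elim hM hrc
  have h11 := key 1 1 one_pos one_pos
  have h12 := key 1 2 one_pos two_pos
  have h21 := key 2 1 two_pos one_pos
  simp only [hilbertPoly_one_left, hilbertPoly_two_left, and_self, if_true] at h11 h12 h21
  norm_num at h12 h21
  have hx : x ≠ 0 := by rintro rfl; simp at h11
  have hy : y ≠ 0 := by rintro rfl; simp at h11
  simp only [hx, hy, false_or, or_false] at h12 h21
  exact ⟨by linarith, by linarith⟩

/-! ### Admissible pairs as increasing positions, and the coproduct `δ` -/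

namespace Adm

/-- The position attached to an index by an admissible pair of maps, in lexicographic order. -/
def pos {n : ℕ} (σ : Adm n) (i : Fin n) : ℕ ×ₗ ℕ :=
  toLex ((σ.2.1.1 i : ℕ), (σ.2.1.2 i : ℕ))

/-- This is admissibility restated: the first coordinate increases weakly, and the second increases
strictly where the first is constant. -/
theorem pos_strictMono {n : ℕ} (σ : Adm n) : StrictMono σ.pos := by
  intro i j hij
  rw [pos, pos, Prod.Lex.toLex_lt_toLex]
  rcases (σ.2.2.2.2.1 hij.le).lt_or_eq with h | h
  · exact Or.inl h
  · exact Or.inr ⟨congrArg Fin.val h, σ.2.2.2.2.2 i j hij h⟩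

theorem ext_pos {n : ℕ} {σ ρ : Adm n} (h1 : (σ.1.1 : ℕ) = ρ.1.1) (h2 : (σ.1.2 : ℕ) = ρ.1.2)
    (h : ∀ i, σ.pos i = ρ.pos i) : σ = ρ := by
  obtain ⟨⟨k, l⟩, ⟨s, t⟩, hs⟩ := σ
  obtain ⟨⟨k', l'⟩, ⟨s', t'⟩, hs'⟩ := ρ
  obtain rfl : k = k' := Fin.ext h1
  obtain rfl : l = l' := Fin.ext h2
  have h3 : s = s' := funext fun i => Fin.ext (congrArg (fun p => (ofLex p).1) (h i))
  have h4 : t = t' := funext fun i => Fin.ext (congrArg (fun p => (ofLex p).2) (h i))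
  subst h3 h4
  rfl

end Adm

namespace PackedMatrix

theorem merge_entry_ne_zero {M : PackedMatrix} {k l : ℕ} {σ : Fin M.row → Fin k}
    {τ : Fin M.col → Fin l} {hσ : Function.Surjective σ} {hτ : Function.Surjective τ}
    (h : (M.merge σ τ hσ hτ).IsDiagonal) {i : Fin M.row} {j : Fin M.col} (hij : M.entry i j ≠ 0) :
    (σ i : ℕ) = τ j := by
  by_contra hne
  exact mapMatrix_mul_mul_ne_zero σ τ hij (h.2 (σ i) (τ j) hne)

section Adm

variable {M : PackedMatrix} {σ : Adm M.row} {τ : Adm M.col}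

theorem pos_eq_pos
    (h1 : (M.merge σ.2.1.1 τ.2.1.1 σ.2.2.1 τ.2.2.1).IsDiagonal)
    (h2 : (M.merge σ.2.1.2 τ.2.1.2 σ.2.2.2.1 τ.2.2.2.1).IsDiagonal)
    {i : Fin M.row} {j : Fin M.col} (hij : M.entry i j ≠ 0) : σ.pos i = τ.pos j := by
  rw [Adm.pos, Adm.pos, merge_entry_ne_zero h1 hij, merge_entry_ne_zero h2 hij]

/-- If both components of a term of `δ(M)` are diagonal, then `M` is diagonal. -/
theorem isDiagonal_of_isDiagonal_merge
    (h1 : (M.merge σ.2.1.1 τ.2.1.1 σ.2.2.1 τ.2.2.1).IsDiagonal)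
    (h2 : (M.merge σ.2.1.2 τ.2.1.2 σ.2.2.2.1 τ.2.2.2.1).IsDiagonal) : M.IsDiagonal := by
  have hpos := fun i j => pos_eq_pos h1 h2 (i := i) (j := j)
  clear h1 h2
  -- Every row and every column has a nonzero entry, which matches its position with one on the
  -- other side.
  have hrange : Set.range σ.pos = Set.range τ.pos := by
    ext p
    constructor
    · rintro ⟨i, rfl⟩
      obtain ⟨j, hj⟩ := M.row_ne_zero i
      exact ⟨j, (hpos i j hj).symm⟩
    · rintro ⟨j, rfl⟩
      obtain ⟨i, hi⟩ := M.col_ne_zero j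
      exact ⟨i, hpos i j hi⟩
  have hcard : M.row = M.col := by
    have h1 := Nat.card_range_of_injective σ.pos_strictMono.injective
    have h2 := Nat.card_range_of_injective τ.pos_strictMono.injective
    rw [hrange, h2] at h1
    simpa using h1.symm
  obtain ⟨r, c, e, hr, hc⟩ := M
  dsimp only at hcard
  subst hcard
  -- Strictly increasing maps with the same range coincide, so a nonzero entry at `(i, j)` forces `i
  -- = j`.
  have heq := (StrictMono.range_inj σ.pos_strictMono τ.pos_strictMono).mp hrange
  refine ⟨rfl, fun i j hij => ?_⟩
  by_contra h0
  have h3 := hpos i j h0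
  rw [heq] at h3
  exact hij (congrArg Fin.val (τ.pos_strictMono.injective h3))

end Adm

variable {n : ℕ} (a : Fin n → ℕ+)

theorem ite_eq_ite_of_iff {P Q : Prop} {hP : Decidable P} {hQ : Decidable Q} (h : P ↔ Q)
    {x y : ℕ} : (if P then x else y) = if Q then x else y := if_congr h rfl rfl

theorem ofDiag_merge_entry {k l : ℕ} (σ : Fin n → Fin k) (τ : Fin n → Fin l)
    (hσ : Function.Surjective σ) (hτ : Function.Surjective τ) (p : Fin k) (q : Fin l) :
    ((ofDiag a).merge σ τ hσ hτ).entry p q =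
      ∑ i, if p = σ i ∧ q = τ i then (a i : ℕ) else 0 := by
  refine (mapMatrix_mul_mul_apply _ _ _ p q).trans (Finset.sum_congr rfl fun b _ => ?_)
  rw [Finset.sum_eq_single b]
  · simp
  · intro i _ hne
    have h0 : (ofDiag a).entry i b = 0 := Matrix.diagonal_apply_ne _ hne
    rw [h0, ite_self]
  · simp

theorem ofDiag_merge_self {k : ℕ} (σ : Fin n → Fin k) (hσ : Function.Surjective σ) :
    (ofDiag a).merge σ σ hσ hσ =
      ofDiag fun p => ⟨∑ i, if σ i = p then (a i : ℕ) else 0, QSym.sum_fibre_pos a σ hσ p⟩ := by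
  refine ext_get rfl rfl fun i j => dite_congr rfl (fun h => ?_) fun _ => rfl
  refine (ofDiag_merge_entry a σ σ hσ hσ _ _).trans ?_
  have h' : i < k ∧ j < k := h
  change _ = Matrix.diagonal _ (⟨i, h'.1⟩ : Fin k) (⟨j, h'.2⟩ : Fin k)
  by_cases hij : i = j
  · subst hij
    rw [Matrix.diagonal_apply_eq]
    exact Finset.sum_congr rfl fun x _ => ite_eq_ite_of_iff ⟨fun h => h.1.symm, fun h => ⟨h.symm, h.symm⟩⟩
  · rw [Matrix.diagonal_apply_ne _ (by simpa using hij)]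
    refine Finset.sum_eq_zero fun x _ => if_neg ?_
    rintro ⟨h1, h2⟩
    exact hij (congrArg Fin.val (h1.trans h2.symm))

theorem rowSums_ofDiag_merge {k l : ℕ} (σ : Fin n → Fin k) (τ : Fin n → Fin l)
    (hσ : Function.Surjective σ) (hτ : Function.Surjective τ) :
    ((ofDiag a).merge σ τ hσ hτ).rowSums = QSym.collapse a σ hσ := by
  refine congrArg List.ofFn (funext fun (p : Fin k) => PNat.coe_injective ?_)
  change ∑ q : Fin l, ((ofDiag a).merge σ τ hσ hτ).entry p q = ∑ i, if σ i = p then (a i : ℕ) else 0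
  refine (Finset.sum_congr rfl fun q _ => ofDiag_merge_entry a σ τ hσ hτ p q).trans ?_
  rw [Finset.sum_comm]
  refine Finset.sum_congr rfl fun i _ => (Finset.sum_eq_single (τ i) ?_ ?_).trans ?_
  · exact fun q _ hq => if_neg fun h => hq h.2
  · exact fun h => absurd (Finset.mem_univ _) h
  · exact ite_eq_ite_of_iff ⟨fun h => h.1.symm, fun h => ⟨h.symm, rfl⟩⟩

theorem colSums_ofDiag_merge {k l : ℕ} (σ : Fin n → Fin k) (τ : Fin n → Fin l)
    (hσ : Function.Surjective σ) (hτ : Function.Surjective τ) :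
    ((ofDiag a).merge σ τ hσ hτ).colSums = QSym.collapse a τ hτ := by
  refine congrArg List.ofFn (funext fun (q : Fin l) => PNat.coe_injective ?_)
  change ∑ p : Fin k, ((ofDiag a).merge σ τ hσ hτ).entry p q = ∑ i, if τ i = q then (a i : ℕ) else 0
  refine (Finset.sum_congr rfl fun p _ => ofDiag_merge_entry a σ τ hσ hτ p q).trans ?_
  rw [Finset.sum_comm]
  refine Finset.sum_congr rfl fun i _ => (Finset.sum_eq_single (σ i) ?_ ?_).trans ?_
  · exact fun p _ hp => if_neg fun h => hp h.1
  · exact fun h => absurd (Finset.mem_univ _) h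
  · exact ite_eq_ite_of_iff ⟨fun h => h.2.symm, fun h => ⟨rfl, h.symm⟩⟩

/-- The packed matrix with reading `a` attached to an admissible pair. -/
def ofAdm (σ : Adm n) : PackedMatrix :=
  (ofDiag a).merge σ.2.1.1 σ.2.1.2 σ.2.2.1 σ.2.2.2.1

theorem weight_ofAdm (σ : Adm n) : (ofAdm a σ).weight = ∑ i, (a i : ℕ) := by
  rw [ofAdm, weight_merge]
  simp [weight, Matrix.diagonal_apply]

/-- The positions of the nonzero entries, in lexicographic order. -/
def support (M : PackedMatrix) : List (ℕ ×ₗ ℕ) :=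
  ((List.range M.row).flatMap fun i => (List.range M.col).map fun j => toLex (i, j)).filter
    fun p => M.get (ofLex p).1 (ofLex p).2 ≠ 0

theorem mem_support {M : PackedMatrix} {p : ℕ ×ₗ ℕ} :
    p ∈ M.support ↔ M.get (ofLex p).1 (ofLex p).2 ≠ 0 := by
  simp only [support, List.mem_filter, List.mem_flatMap, List.mem_range, List.mem_map,
    decide_eq_true_eq, and_iff_right_iff_imp]
  intro h
  obtain ⟨h1, h2⟩ := get_ne_zero h
  exact ⟨_, h1, _, h2, rfl⟩

theorem pairwise_support (M : PackedMatrix) : M.support.Pairwise (· < ·) := by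
  refine List.Pairwise.filter _ (List.pairwise_flatMap.mpr ⟨fun i _ => ?_, ?_⟩)
  · rw [List.pairwise_map]
    refine List.pairwise_lt_range.imp fun h => ?_
    rw [Prod.Lex.toLex_lt_toLex]
    exact Or.inr ⟨rfl, h⟩
  · refine List.pairwise_lt_range.imp fun h p hp q hq => ?_
    obtain ⟨_, -, rfl⟩ := List.mem_map.mp hp
    obtain ⟨_, -, rfl⟩ := List.mem_map.mp hq
    rw [Prod.Lex.toLex_lt_toLex]
    exact Or.inl h

/-- Reading row by row visits the positions in lexicographic order, so deleting zeros before or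
after forgetting the positions gives the same values. -/
theorem map_reading (M : PackedMatrix) : M.reading.map (fun m : ℕ+ => (m : ℕ)) =
    M.support.map fun p => M.get (ofLex p).1 (ofLex p).2 := by
  have h1 : ∀ l : List ℕ, (l.filterMap fun n => if h : 0 < n then some (⟨n, h⟩ : ℕ+) else none).map
      (fun m : ℕ+ => (m : ℕ)) = l.filter (· ≠ 0) := by
    intro l
    induction l with
    | nil => rfl
    | cons n l ih =>
      rcases Nat.eq_zero_or_pos n with rfl | hn
      · simpa using ih
      · simp only [List.filterMap_cons, dif_pos hn, List.filter_cons, hn.ne', ne_eq,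
          not_false_eq_true, decide_true, if_true]
        exact congrArg (List.cons n) ih
  have h2 : ∀ {α : Type} (m : ℕ) (f : ℕ → α),
      (List.ofFn fun i : Fin m => f i) = (List.range m).map f := by
    intro α m f
    refine List.ext_getElem (by simp) fun i _ _ => by simp
  refine (h1 _).trans ?_
  simp only [← get_val]
  rw [h2 M.row fun i => List.ofFn fun j : Fin M.col => M.get i j]
  simp only [h2 M.col]
  have h3 : (List.range M.row).flatMap (fun i => (List.range M.col).map fun j => M.get i j) =
      ((List.range M.row).flatMap fun i => (List.range M.col).map fun j => toLex (i, j)).map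
        fun p => M.get (ofLex p).1 (ofLex p).2 := by
    rw [List.map_flatMap]
    simp only [List.map_map]
    rfl
  rw [← List.flatMap_def, h3, List.filter_map]
  rfl

theorem get_ofAdm (σ : Adm n) (p q : ℕ) :
    (ofAdm a σ).get p q = ∑ i, if toLex (p, q) = σ.pos i then (a i : ℕ) else 0 := by
  have hpos : ∀ i, toLex (p, q) = σ.pos i ↔ p = σ.2.1.1 i ∧ q = σ.2.1.2 i := by
    intro i
    rw [Adm.pos, toLex_inj, Prod.mk.injEq]
  simp only [hpos]
  by_cases h : p < (σ.1.1 : ℕ) ∧ q < (σ.1.2 : ℕ)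
  · refine (dif_pos h).trans ((ofDiag_merge_entry a _ _ σ.2.2.1 σ.2.2.2.1 _ _).trans ?_)
    refine Finset.sum_congr rfl fun i _ => ?_
    exact ite_eq_ite_of_iff (and_congr Fin.ext_iff Fin.ext_iff)
  · refine (dif_neg h).trans (Finset.sum_eq_zero fun i _ => if_neg ?_).symm
    rintro ⟨rfl, rfl⟩
    exact h ⟨Fin.is_lt _, Fin.is_lt _⟩

theorem get_ofAdm_pos (σ : Adm n) (i : Fin n) :
    (ofAdm a σ).get (ofLex (σ.pos i)).1 (ofLex (σ.pos i)).2 = a i := by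
  rw [get_ofAdm, Finset.sum_eq_single i]
  · exact if_pos rfl
  · intro j _ hne
    exact if_neg fun h => hne (σ.pos_strictMono.injective h).symm
  · simp

/-- Two strictly increasing lists with the same members are equal. -/
theorem support_ofAdm (σ : Adm n) : (ofAdm a σ).support = List.ofFn σ.pos := by
  refine (pairwise_support _).eq_of_mem_iff (List.pairwise_ofFn.mpr fun i j h =>
    σ.pos_strictMono h) fun p => ?_
  rw [mem_support, List.mem_ofFn]
  constructor
  · intro h
    rw [get_ofAdm] at h
    obtain ⟨i, -, hi⟩ := Finset.exists_ne_zero_of_sum_ne_zero h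
    refine ⟨i, ?_⟩
    by_contra hne
    exact hi (if_neg fun h' => hne h'.symm)
  · rintro ⟨i, rfl⟩
    rw [get_ofAdm_pos]
    exact (a i).ne_zero

theorem reading_ofAdm (σ : Adm n) : (ofAdm a σ).reading = List.ofFn a := by
  apply List.map_injective_iff.mpr PNat.coe_injective
  refine (map_reading _).trans ?_
  rw [support_ofAdm, List.map_ofFn, List.map_ofFn]
  exact congrArg List.ofFn (funext fun i => get_ofAdm_pos a σ i)

theorem ofAdm_injective : Function.Injective (ofAdm a) := by
  intro σ ρ h
  have hs := congrArg support h
  rw [support_ofAdm, support_ofAdm] at hs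
  exact Adm.ext_pos (congrArg row h) (congrArg col h) (congrFun (List.ofFn_injective hs))

/-- The pair sends `i` to the row and the column of the `i`-th nonzero entry. Packedness gives
surjectivity of both maps, and the lexicographic order of the positions gives admissibility. -/
theorem exists_ofAdm_eq {M : PackedMatrix} (h : M.reading = List.ofFn a) :
    ∃ σ : Adm n, ofAdm a σ = M := by
  have hmap := M.map_reading
  rw [h] at hmap
  have hlen : M.support.length = n := by
    have := congrArg List.length hmap
    simpa using this.symm
  let s : Fin n → ℕ ×ₗ ℕ := fun i => M.support[i]
  have hs : StrictMono s := fun i j hij =>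
    List.pairwise_iff_getElem.mp M.pairwise_support i j (by omega) (by omega) hij
  have hget : ∀ i, M.get (ofLex (s i)).1 (ofLex (s i)).2 = a i := by
    intro i
    have := congrArg (fun l : List ℕ => l[(i : ℕ)]?) hmap
    simpa [s, hlen] using this.symm
  have hne : ∀ i, M.get (ofLex (s i)).1 (ofLex (s i)).2 ≠ 0 := fun i => by
    rw [hget]
    exact (a i).ne_zero
  have hmem : ∀ p q, M.get p q ≠ 0 → ∃ i, s i = toLex (p, q) := by
    intro p q hpq
    obtain ⟨i, hi, h'⟩ := List.mem_iff_getElem.mp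
      (mem_support (p := toLex (p, q)).mpr hpq)
    exact ⟨⟨i, hlen ▸ hi⟩, h'⟩
  let s₁ : Fin n → Fin M.row := fun i => ⟨(ofLex (s i)).1, (get_ne_zero (hne i)).1⟩
  let s₂ : Fin n → Fin M.col := fun i => ⟨(ofLex (s i)).2, (get_ne_zero (hne i)).2⟩
  have hs₁ : Function.Surjective s₁ := by
    intro p
    obtain ⟨q, hq⟩ := M.exists_get_row p.2
    obtain ⟨i, hi⟩ := hmem p q hq
    exact ⟨i, Fin.ext (by simp [s₁, hi])⟩
  have hs₂ : Function.Surjective s₂ := by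
    intro q
    obtain ⟨p, hp⟩ := M.exists_get_col q.2
    obtain ⟨i, hi⟩ := hmem p q hp
    exact ⟨i, Fin.ext (by simp [s₂, hi])⟩
  have hr : M.row ≤ n := by simpa using Fintype.card_le_of_surjective _ hs₁
  have hc : M.col ≤ n := by simpa using Fintype.card_le_of_surjective _ hs₂
  let σ : Adm n := ⟨(⟨M.row, by omega⟩, ⟨M.col, by omega⟩), (s₁, s₂), hs₁, hs₂, by
    intro i j hij
    exact Prod.Lex.monotone_fst _ _ (hs.monotone hij), by
    intro i j hij heq
    rcases Prod.Lex.lt_iff.mp (hs hij) with h' | h'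
    · exact absurd (congrArg Fin.val heq) h'.ne
    · exact h'.2⟩
  have hσ : ∀ i, σ.pos i = s i := fun i => rfl
  refine ⟨σ, ext_get rfl rfl fun p q => ?_⟩
  rw [get_ofAdm]
  by_cases h0 : M.get p q = 0
  · rw [h0]
    refine Finset.sum_eq_zero fun i _ => if_neg fun h' => hne i ?_
    rw [← hσ, ← h']
    exact h0
  · obtain ⟨i, hi⟩ := hmem p q h0
    rw [← hi, ← hσ, Finset.sum_eq_single i, if_pos rfl, ← hget, hi]
    · rfl
    · intro j _ hj
      exact if_neg fun h' => hj (hs.injective h').symm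
    · simp

end PackedMatrix

/-! ### Compatibility of `κ_{1,1}` with `δ` -/

/-- Through the bijection `ofAdm`, the coproduct of QSym is indexed by the same admissible pairs as
that of `H_Pack`. -/
theorem QSym.comul₂_basis {n : ℕ} (a : Fin n → ℕ+) :
    QSym.comul₂ (QSym.basis (List.ofFn a)) = ∑ σ : Adm n,
      QSym.basis (QSym.collapse a σ.2.1.1 σ.2.2.1) ⊗ₜ[ℚ]
        QSym.basis (QSym.collapse a σ.2.1.2 σ.2.2.2.1) := by
  rw [QSym.comul₂, Finsupp.linearCombination_single, one_smul]
  symm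
  refine Finset.sum_bij (fun σ _ => ofAdm a σ) ?_ (fun σ _ ρ _ h => ofAdm_injective a h) ?_ ?_
  · intro σ _
    rw [Finset.mem_filter, mem_ofWeight]
    refine ⟨?_, reading_ofAdm a σ⟩
    rw [weight_ofAdm, List.map_ofFn, List.sum_ofFn]
    rfl
  · intro M hM
    obtain ⟨σ, hσ⟩ := exists_ofAdm_eq a (Finset.mem_filter.mp hM).2
    exact ⟨σ, Finset.mem_univ _, hσ⟩
  · intro σ _
    rw [ofAdm, rowSums_ofDiag_merge, colSums_ofDiag_merge]

theorem kappa_one_one_comul₂ (X : HPack) : QSym.comul₂ (kappa 1 1 X) =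
    TensorProduct.map (kappa 1 1) (kappa 1 1) (HPack.comul₂ X) := by
  suffices h : QSym.comul₂ ∘ₗ kappa 1 1 =
      TensorProduct.map (kappa 1 1) (kappa 1 1) ∘ₗ HPack.comul₂ from LinearMap.congr_fun h X
  refine Finsupp.lhom_ext' fun M => LinearMap.ext_ring ?_
  change QSym.comul₂ (kappa 1 1 (HPack.basis M)) =
    TensorProduct.map (kappa 1 1) (kappa 1 1) (HPack.comul₂ (HPack.basis M))
  rw [HPack.comul₂, Finsupp.linearCombination_single, one_smul]
  simp only [map_sum, TensorProduct.map_tmul]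
  have hzero : ∀ (P Q : PackedMatrix), ¬ (P.IsDiagonal ∧ Q.IsDiagonal) →
      kappa 1 1 (HPack.basis P) ⊗ₜ[ℚ] kappa 1 1 (HPack.basis Q) = 0 := by
    intro P Q h
    by_cases hP : P.IsDiagonal
    · rw [kappa_one_one_of_not_isDiagonal Q fun hQ => h ⟨hP, hQ⟩, TensorProduct.tmul_zero]
    · rw [kappa_one_one_of_not_isDiagonal P hP, TensorProduct.zero_tmul]
  by_cases hM : M.IsDiagonal
  · obtain ⟨n, a, rfl⟩ := hM.exists_eq_ofDiag
    rw [kappa_one_one_ofDiag, QSym.comul₂_basis]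
    refine Finset.sum_congr rfl fun σ _ => ?_
    rw [Finset.sum_eq_single σ]
    · rw [ofDiag_merge_self, ofDiag_merge_self]
      exact (congrArg₂ (· ⊗ₜ[ℚ] ·) (kappa_one_one_ofDiag _) (kappa_one_one_ofDiag _)).symm
    -- If both tensor factors were diagonal, the nonzero entry at `(i, i)` would give `σ` and `τ`
    -- the same position at each `i`, hence `τ = σ`.
    · intro τ _ hne
      refine hzero _ _ fun h => hne ?_
      refine Adm.ext_pos h.1.1.symm h.2.1.symm fun i => ?_
      exact (pos_eq_pos (M := ofDiag a) (σ := σ) (τ := τ) h.1 h.2 (i := i) (j := i)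
        (by simp)).symm
    · simp
  · rw [kappa_one_one_of_not_isDiagonal M hM, map_zero]
    symm
    refine Finset.sum_eq_zero fun σ _ => Finset.sum_eq_zero fun τ _ => hzero _ _ fun h => hM ?_
    exact isDiagonal_of_isDiagonal_merge h.1 h.2

theorem isDoubleBialgebraMorphism_kappa_one_one :
    IsDoubleBialgebraMorphism HPack.structureMaps QSym.structureMaps (kappa 1 1) where
  toIsBialgebraMorphism := isBialgebraMorphism_kappa 1 1
  map_comul₂ := kappa_one_one_comul₂
  map_counit₂ := kappa_one_one_counit₂

end

theorem mainTheorem4 :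
    (∀ x y : ℚ,
      -- `κ_{x,y}` is the transpose of `K_{x,y}`
      (∀ (M : PackedMatrix) (a : List ℕ+),
        kappa x y (HPack.basis M) a = bigK x y (Finsupp.single a 1) M) ∧
      IsBialgebraMorphism HPack.structureMaps QSym.structureMaps (kappa x y) ∧
      (IsDoubleBialgebraMorphism HPack.structureMaps QSym.structureMaps (kappa x y) ↔
        x = 1 ∧ y = 1)) ∧
    (∀ (M : PackedMatrix) (h : M.IsDiagonal),
      kappa 1 1 (HPack.basis M) = QSym.basis (M.diag h)) ∧
    (∀ M : PackedMatrix, ¬ M.IsDiagonal → kappa 1 1 (HPack.basis M) = 0) := by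
  refine ⟨fun x y => ⟨fun M a => ?_, isBialgebraMorphism_kappa x y,
    eq_one_of_isDoubleBialgebraMorphism, ?_⟩, kappa_one_one_of_isDiagonal,
    kappa_one_one_of_not_isDiagonal⟩
  · rw [kappa_basis_apply, bigK_basis_apply]
  · rintro ⟨rfl, rfl⟩
    exact isDoubleBialgebraMorphism_kappa_one_one
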